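/- \textbf{Definitions.} Let $\omega=\{0,1,2,\dots\}$ and let $P=\{f_i : i\in\omega\}$ be a set of pairwise different attributes. A \emph{binary decision table} $T$ is a finite rectangular table filled with numbers from $\{0,1\}$, with pairwise different rows, each labeled with a nonempty finite subset of $\omega$ (its set of decisions), and with columns labeled with pairwise different attributes, which form the set $\operatorname{At}(T)$. All tables without rows and all tables without columns are identified with one empty table $\Lambda$, with $\operatorname{At}(\Lambda)=\emptyset$. A \emph{closed class} is a nonempty set $A$ of binary decision tables with $A=\bigcup_{T\in A}[T]$, where $[T]$ is the set of all tables obtained from $T$ by removing the columns labeled with the attributes of some set $D\subseteq\operatorname{At}(T)$, keeping the first row in each group of rows that become equal (the result is $\Lambda$ if $D=\operatorname{At}(T)$), and then replacing the set of decisions of every row $\bar\delta$ by $\nu(\bar\delta)$, where $\nu$ is any map from tuples to nonempty finite subsets of $\omega$. The class $A$ is \emph{nontrivial} if it contains a table different from $\Lambda$. A \emph{bounded complexity measure} is a function $\psi$ from the set of finite words over $P$ to $\omega$ such that, for all words $\alpha,\beta$: $\psi(\alpha)=0$ if and only if $\alpha$ is empty; $\psi(\alpha)$ is invariant under permutation of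 the letters of $\alpha$; $\psi(\alpha)\le\psi(\alpha\beta)\le\psi(\alpha)+\psi(\beta)$; and $\psi(\alpha)\ge|\alpha|$. For a word $\alpha=(f_{i_1},\delta_1)\cdots(f_{i_m},\delta_m)$ of pairs put $\psi(\alpha)=\psi(f_{i_1}\cdots f_{i_m})$. If $T\ne\Lambda$, a \emph{word of} $T$ is a finite (possibly empty) word $\alpha$ of pairs $(f,\delta)$ with $f\in\operatorname{At}(T)$ and $\delta\in\{0,1\}$, and $T\alpha$ is the subtable of $T$ that consists of the rows having the number $\delta$ in the column $f$ for each letter $(f,\delta)$ of $\alpha$ (it is $\Lambda$ if there are no such rows). A \emph{decision tree} is a finite rooted directed tree with at least two nodes, in which the root and the edges leaving it are unlabeled, each terminal node is labeled with a number from $\omega$, each other non-root node is labeled with an attribute, and the edges leaving such a node are labeled with numbers from $\{0,1\}$. A path $\tau$ from the root to a terminal node has the word $\pi(\tau)$ of the pairs (attribute of a node, number of the edge leaving it) along $\tau$, and $\psi(\Gamma)$ is the maximum of $\psi(\pi(\tau))$ over all such paths $\tau$ of $\Gamma$. Such a tree $\Gamma$ is a \emph{nondeterministic decision tree for} $T\neq\Lambda$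 if its attributes belong to $\operatorname{At}(T)$, each row of $T$ belongs to $T\pi(\tau)$ for some path $\tau$, and for each path $\tau$ either $T\pi(\tau)=\Lambda$ or the label of the terminal node of $\tau$ belongs to the sets of decisions of all rows of $T\pi(\tau)$. It is \emph{deterministic} if, in addition, exactly one edge leaves the root and the edges leaving any node other than the root have pairwise different labels. Let $\psi^d(T)$ and $\psi^a(T)$ be the minimum of $\psi(\Gamma)$ over the deterministic and over the nondeterministic decision trees for $T$, respectively. For $T\ne\Lambda$ put $m_\psi(T)=\max\{\psi(f):f\in\operatorname{At}(T)\}$. Let $Z(T)$ be the maximum number of columns of a table $Q\in[T]$ with exactly $2^{|\operatorname{At}(Q)|}$ rows, and $0$ if there is no such $Q$. A word $\alpha$ of $T$ is \emph{annihilating} if $T\alpha=\Lambda$ and $\alpha$ does not contain both $(f,0)$ and $(f,1)$ for any $f$; it is \emph{irreducible} if no word different from $\alpha$ obtained from $\alpha$ by removal of letters is annihilating. Let $G(T)$ be the maximum length of an irreducible annihilating word of $T$, and $0$ if there are none. For $n\in\omega$, let $l_\psi(T,n)$ be the maximum cardinality of a finite set $U$ of words $\alpha$ of $T$ with $\psi(\alpha)\le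 n$ such that each row of $T$ belongs to $T\alpha$ for some $\alpha\in U$ and no proper subset of $U$ has this property. All these parameters are $0$ for $T=\Lambda$. For a nontrivial closed class $A$ and $n\in\omega$, let $A_\psi(n)=\{T\in A: m_\psi(T)\le n\}$ and $$\mathcal H^\infty_{\psi,A}(n)=\max\{\psi^d(T):T\in A,\ \psi^a(T)\le n\},\qquad L_{\psi,A}(n)=\max\{l_\psi(T,n):T\in A\},$$ $$Z_{\psi,A}(n)=\max\{Z(T):T\in A_\psi(n)\},\qquad G_{\psi,A}(n)=\max\{G(T):T\in A_\psi(n)\},$$ each value being undefined if the corresponding set is infinite. \textbf{Theorem.} Let $A$ be a nontrivial closed class of binary decision tables, let $\psi$ be a bounded complexity measure, and suppose that $\mathcal H^\infty_{\psi,A}(n)$ is defined for every $n\in\omega$. Then there is a polynomial $p_0$ with $\mathcal H^\infty_{\psi,A}(n)\le p_0(n)$ for all $n\in\omega$ if and only if there are polynomials $p_1,p_2,p_3$ such that, for all $n\in\omega$, the values $Z_{\psi,A}(n)$, $G_{\psi,A}(n)$, $L_{\psi,A}(n)$ are defined and $$Z_{\psi,A}(n)\le p_1(n),\qquad G_{\psi,A}(n)\le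 p_2(n),\qquad L_{\psi,A}(n)\le 2^{p_3(n)}.$$ -/

import Mathlib

/-! Attributes `f_i` are represented by their indices `i : ℕ`, decisions are natural numbers,
and `E_k` is `Fin k`. -/

namespace DecisionTables

/-- A nonempty finite set of decisions. -/
abbrev DecisionSet : Type := {s : Finset ℕ // s.Nonempty}

/-- A finite word over the alphabet of pairs (attribute, value). -/
abbrev Word (k : ℕ) : Type := List (ℕ × Fin k)

/-- A row: the tuple of values (in the order of the columns) and its set of decisions. -/
abbrev Row (k : ℕ) : Type := List (Fin k) × DecisionSet

/-- Decision tables with many-valued decisions. All tables without rows are identified with one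
empty table `Λ`, which has no columns; a table without columns is `Λ` as well. -/
@[ext]
structure Table (k : ℕ) where
  cols : List ℕ
  rows : List (Row k)
  cols_nodup : cols.Nodup
  rows_length : ∀ r ∈ rows, r.1.length = cols.length
  rows_nodup : (rows.map Prod.fst).Nodup
  cols_eq_nil_iff : cols = [] ↔ rows = []

namespace Table

variable {k : ℕ}

/-- The empty table `Λ`. -/
def empty (k : ℕ) : Table k where
  cols := []
  rows := []
  cols_nodup := List.nodup_nil
  rows_length := by simp
  rows_nodup := by simp
  cols_eq_nil_iff := by simp

/-- The table with the given columns and rows; it is `Λ` if there are no columns or no rows. -/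
def build (cols : List ℕ) (rows : List (Row k)) (hc : cols.Nodup)
    (hl : ∀ r ∈ rows, r.1.length = cols.length) (hr : (rows.map Prod.fst).Nodup) : Table k :=
  if h : cols ≠ [] ∧ rows ≠ [] then
    { cols := cols
      rows := rows
      cols_nodup := hc
      rows_length := hl
      rows_nodup := hr
      cols_eq_nil_iff := ⟨fun h' => absurd h' h.1, fun h' => absurd h' h.2⟩ }
  else empty k

/-- `At(T)`. -/
def attrs (T : Table k) : Finset ℕ := T.cols.toFinset

/-- `Δ(T)`, the set of rows (tuples of values). -/
def tuples (T : Table k) : Finset (List (Fin k)) := (T.rows.map Prod.fst).toFinset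

/-- `d` is a common decision for `T`. -/
def IsCommonDecision (T : Table k) (d : ℕ) : Prop := ∀ r ∈ T.rows, d ∈ r.2.1

/-- `α ∈ Ω_k(T)`: only attributes of `T` occur in the word `α`. -/
def IsWord (T : Table k) (α : Word k) : Prop := ∀ a ∈ α, a.1 ∈ T.attrs

/-- The subtable `Tα`: keep the rows that have, for each letter `(f, δ)` of `α`, the number `δ`
in the column labeled with `f`. -/
def subtable (T : Table k) (α : Word k) : Table k :=
  build T.cols (T.rows.filter fun r => ∀ a ∈ α, a ∈ T.cols.zip r.1) T.cols_nodup
    (fun r hr => T.rows_length r (List.mem_of_mem_filter hr))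
    (T.rows_nodup.sublist (List.filter_sublist.map _))

/-- In each group of rows with equal tuples of values, keep the first one. -/
def keepFirst : List (Row k) → List (Row k)
  | [] => []
  | r :: l => r :: (keepFirst l).filter fun s => s.1 ≠ r.1

theorem mem_of_mem_keepFirst {l : List (Row k)} {r : Row k} (h : r ∈ keepFirst l) : r ∈ l := by
  induction l with
  | nil => simp [keepFirst] at h
  | cons a l ih =>
    rcases List.mem_cons.1 h with h | h
    · exact h ▸ List.mem_cons_self
    · exact List.mem_cons_of_mem _ (ih (List.mem_of_mem_filter h))

theorem nodup_keepFirst (l : List (Row k)) : ((keepFirst l).map Prod.fst).Nodup := by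
  induction l with
  | nil => simp [keepFirst]
  | cons a l ih =>
    rw [keepFirst, List.map_cons, List.nodup_cons]
    refine ⟨fun h => ?_, ih.sublist (List.filter_sublist.map _)⟩
    obtain ⟨s, hs, hsa⟩ := List.mem_map.1 h
    have := (List.mem_filter.1 hs).2
    simp [hsa] at this

/-- Remove from a row the entries in the columns labeled with attributes from `D`. -/
def removeEntries (cols : List ℕ) (D : Finset ℕ) (r : Row k) : Row k :=
  (((cols.zip r.1).filter fun a => a.1 ∉ D).map Prod.snd, r.2)

theorem length_removeEntries (cols : List ℕ) (D : Finset ℕ) (r : Row k)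
    (h : r.1.length = cols.length) :
    (removeEntries cols D r).1.length = (cols.filter fun f => f ∉ D).length := by
  have : cols = (cols.zip r.1).map Prod.fst := by rw [List.map_fst_zip h.ge]
  conv_rhs => rw [this]
  rw [List.filter_map, List.length_map, removeEntries, List.length_map]
  rfl

/-- Removal of columns, `I(D, T)`. -/
def removeColumns (D : Finset ℕ) (T : Table k) : Table k :=
  build (T.cols.filter fun f => f ∉ D) (keepFirst (T.rows.map (removeEntries T.cols D)))
    (T.cols_nodup.filter _)
    (fun r hr => by
      obtain ⟨s, hs, rfl⟩ := List.mem_map.1 (mem_of_mem_keepFirst hr)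
      exact length_removeEntries _ _ _ (T.rows_length s hs))
    (nodup_keepFirst _)

/-- Changing of decisions, `J(ν, T)`. Only the values of `ν` on tuples of length `|At(T)|`
are used. -/
def changeDecisions (ν : List (Fin k) → DecisionSet) (T : Table k) : Table k where
  cols := T.cols
  rows := T.rows.map fun r => (r.1, ν r.1)
  cols_nodup := T.cols_nodup
  rows_length := by
    intro r hr
    obtain ⟨s, hs, rfl⟩ := List.mem_map.1 hr
    exact T.rows_length s hs
  rows_nodup := by
    rw [List.map_map]
    exact T.rows_nodup
  cols_eq_nil_iff := by rw [List.map_eq_nil_iff]; exact T.cols_eq_nil_iff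

/-- The closure `[T]` under removal of columns and changing of decisions. -/
def closure (T : Table k) : Set (Table k) :=
  {Q | ∃ D ⊆ T.attrs, ∃ ν : List (Fin k) → DecisionSet, Q = changeDecisions ν (removeColumns D T)}

end Table

/-- `A` is a closed class: `A ≠ ∅` and `[A] = A`. -/
def IsClosedClass {k : ℕ} (A : Set (Table k)) : Prop :=
  A.Nonempty ∧ (⋃ T ∈ A, T.closure) = A

/-- `A` contains a nonempty table. -/
def IsNontrivialClass {k : ℕ} (A : Set (Table k)) : Prop :=
  ∃ T ∈ A, T ≠ Table.empty k

/-- A non-root node of a `k`-decision tree, with everything below it: either a terminal node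
labeled with a decision, or a node labeled with an attribute and having `n + 1` leaving edges,
the `i`-th one labeled with `label i` and entering the node `child i`. -/
inductive Node (k : ℕ) : Type
  | terminal (d : ℕ) : Node k
  | query (f : ℕ) (n : ℕ) (label : Fin (n + 1) → Fin k) (child : Fin (n + 1) → Node k) : Node k

namespace Node

variable {k : ℕ}

/-- The attributes attached to the nodes. -/
def attrs : Node k → Finset ℕ
  | terminal _ => ∅
  | query f _ _ child => insert f (Finset.univ.biUnion fun i => (child i).attrs)

/-- The paths from this node to terminal nodes, each given by its word of pairs
(attribute, number) and the decision at its terminal node. -/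
def paths : Node k → Finset (Word k × ℕ)
  | terminal d => {([], d)}
  | query f _ label child =>
      Finset.univ.biUnion fun i => (child i).paths.image fun p => ((f, label i) :: p.1, p.2)

/-- The edges leaving each node are labeled with pairwise different numbers. -/
def IsDeterministic : Node k → Prop
  | terminal _ => True
  | query _ _ label child => Function.Injective label ∧ ∀ i, (child i).IsDeterministic

end Node

/-- A `k`-decision tree: an unlabeled root with `m + 1` unlabeled leaving edges, the `i`-th one
entering the node `child i`. -/
structure Tree (k : ℕ) where
  m : ℕ
  child : Fin (m + 1) → Node k

namespace Tree

variable {k : ℕ}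

/-- `At(Γ)`. -/
def attrs (Γ : Tree k) : Finset ℕ := Finset.univ.biUnion fun i => (Γ.child i).attrs

/-- The complete paths `τ` of `Γ`, each given by the word `π(τ)` and the decision at the
terminal node of `τ`. -/
def paths (Γ : Tree k) : Finset (Word k × ℕ) := Finset.univ.biUnion fun i => (Γ.child i).paths

/-- `Γ` is a nondeterministic decision tree for `T`. -/
def IsNondeterministicFor (Γ : Tree k) (T : Table k) : Prop :=
  Γ.attrs ⊆ T.attrs ∧
  (∀ δ ∈ T.tuples, ∃ p ∈ Γ.paths, δ ∈ (T.subtable p.1).tuples) ∧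
  ∀ p ∈ Γ.paths, T.subtable p.1 = Table.empty k ∨ (T.subtable p.1).IsCommonDecision p.2

/-- `Γ` is a deterministic decision tree for `T`; in particular, only one edge leaves the root. -/
def IsDeterministicFor (Γ : Tree k) (T : Table k) : Prop :=
  Γ.m = 0 ∧ (∀ i, (Γ.child i).IsDeterministic) ∧ Γ.IsNondeterministicFor T

end Tree

/-- Partially bounded complexity measures on words over the set of attributes. -/
structure IsPartiallyBoundedMeasure (ψ : List ℕ → ℕ) : Prop where
  eq_zero_iff : ∀ α, ψ α = 0 ↔ α = []
  perm : ∀ α β : List ℕ, α.Perm β → ψ α = ψ β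
  le_append : ∀ α β, ψ α ≤ ψ (α ++ β)
  append_le : ∀ α β, ψ (α ++ β) ≤ ψ α + ψ β

/-- Bounded complexity measures. -/
structure IsBoundedMeasure (ψ : List ℕ → ℕ) : Prop extends IsPartiallyBoundedMeasure ψ where
  length_le : ∀ α, α.length ≤ ψ α

section Parameters

variable {k : ℕ} (ψ : List ℕ → ℕ)

/-- The extension of `ψ` to words over pairs (attribute, value). -/
def wordComplexity (α : Word k) : ℕ := ψ (α.map Prod.fst)

/-- The complexity `ψ(Γ)` of a decision tree. -/
def treeComplexity (Γ : Tree k) : ℕ := Γ.paths.sup fun p => wordComplexity ψ p.1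

open Classical in
/-- `ψ^d(T)`. -/
noncomputable def detComplexity (T : Table k) : ℕ :=
  if T = Table.empty k then 0
  else sInf {c | ∃ Γ : Tree k, Γ.IsDeterministicFor T ∧ treeComplexity ψ Γ = c}

open Classical in
/-- `ψ^a(T)`. -/
noncomputable def nondetComplexity (T : Table k) : ℕ :=
  if T = Table.empty k then 0
  else sInf {c | ∃ Γ : Tree k, Γ.IsNondeterministicFor T ∧ treeComplexity ψ Γ = c}

/-- `m_ψ(T)`, the maximum of `ψ(f)` over the attributes `f` of `T`. -/
def maxAttrComplexity (T : Table k) : ℕ := T.attrs.sup fun f => ψ [f]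

/-- `U` is a `(ψ, n)`-cover of `T`. -/
def IsCover (T : Table k) (n : ℕ) (U : Finset (Word k)) : Prop :=
  (∀ α ∈ U, T.IsWord α ∧ wordComplexity ψ α ≤ n) ∧
  (U.biUnion fun α => (T.subtable α).tuples) = T.tuples

/-- `U` is an irreducible `(ψ, n)`-cover of `T`. -/
def IsIrreducibleCover (T : Table k) (n : ℕ) (U : Finset (Word k)) : Prop :=
  IsCover ψ T n U ∧ ∀ V ⊂ U, ¬ IsCover ψ T n V

open Classical in
/-- `l_ψ(T, n)`, the maximum cardinality of an irreducible `(ψ, n)`-cover of `T`. -/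
noncomputable def coverNumber (T : Table k) (n : ℕ) : ℕ :=
  if T = Table.empty k then 0
  else sSup {c | ∃ U : Finset (Word k), IsIrreducibleCover ψ T n U ∧ U.card = c}

end Parameters

/-- A binary table is complete if the number of its rows is `2 ^ |At(Q)|`. -/
def IsComplete (Q : Table 2) : Prop := Q.rows.length = 2 ^ Q.attrs.card

open Classical in
/-- `Z(T)`, the maximum number of columns of a complete table from `[T]`
(`0` if there are no such tables). -/
noncomputable def completeDim (T : Table 2) : ℕ :=
  if T = Table.empty 2 then 0
  else sSup {m | ∃ Q ∈ T.closure, IsComplete Q ∧ Q.cols.length = m}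

/-- `α` is an annihilating word for `T`. -/
def IsAnnihilating (T : Table 2) (α : Word 2) : Prop :=
  T.IsWord α ∧ T.subtable α = Table.empty 2 ∧
  ∀ (f : ℕ) (δ σ : Fin 2), (f, δ) ∈ α → (f, σ) ∈ α → δ = σ

/-- `α` is an irreducible annihilating word for `T`. -/
def IsIrreducibleAnnihilating (T : Table 2) (α : Word 2) : Prop :=
  IsAnnihilating T α ∧ ∀ β : Word 2, β.Sublist α → β ≠ α → ¬ IsAnnihilating T β

open Classical in
/-- `G(T)`, the maximum length of an irreducible annihilating word for `T`
(`0` if there are no such words). -/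
noncomputable def annihilatingLength (T : Table 2) : ℕ :=
  if T = Table.empty 2 then 0
  else sSup {m | ∃ α : Word 2, IsIrreducibleAnnihilating T α ∧ α.length = m}

/-- The maximum of a nonempty set of natural numbers, undefined if the set is infinite. -/
noncomputable def partialMax (S : Set ℕ) : Part ℕ := ⟨S.Finite, fun _ => sSup S⟩

/-- The partial function `H^∞_{ψ,A}`. -/
noncomputable def funH {k : ℕ} (ψ : List ℕ → ℕ) (A : Set (Table k)) : ℕ →. ℕ := fun n =>
  partialMax {c | ∃ T ∈ A, nondetComplexity ψ T ≤ n ∧ detComplexity ψ T = c}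

/-- The partial function `L_{ψ,A}`. -/
noncomputable def funL {k : ℕ} (ψ : List ℕ → ℕ) (A : Set (Table k)) : ℕ →. ℕ := fun n =>
  partialMax {c | ∃ T ∈ A, coverNumber ψ T n = c}

/-- The class `A_ψ(n)` of the tables from `A` all of whose attributes have complexity
at most `n`. -/
def boundedSubclass {k : ℕ} (ψ : List ℕ → ℕ) (A : Set (Table k)) (n : ℕ) : Set (Table k) :=
  {T | T ∈ A ∧ maxAttrComplexity ψ T ≤ n}

/-- The partial function `Z_{ψ,A}`. -/
noncomputable def funZ (ψ : List ℕ → ℕ) (A : Set (Table 2)) : ℕ →. ℕ := fun n =>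
  partialMax {c | ∃ T ∈ boundedSubclass ψ A n, completeDim T = c}

/-- The partial function `G_{ψ,A}`. -/
noncomputable def funG (ψ : List ℕ → ℕ) (A : Set (Table 2)) : ℕ →. ℕ := fun n =>
  partialMax {c | ∃ T ∈ boundedSubclass ψ A n, annihilatingLength T = c}

/-- The partial function is defined at every natural number. -/
def EverywhereDefined (F : ℕ →. ℕ) : Prop := ∀ n, (F n).Dom

end DecisionTables

namespace DecisionTables

/-! A row is identified with the set of attributes where it has a `1`, so a table becomes a finite
family of finite sets and each tree or cover condition becomes a statement about `Agrees`. Since the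
decisions in a closed class are arbitrary, search problems can be planted in any table of the class.

Necessity: if one of the parameters is large, a suitable choice of decisions gives a table with
small `ψ^a` and large `ψ^d`. On a complete table one plants the pigeonhole search problem with `2 ^
t + 1` pigeons and `2 ^ t` holes: a collision is certified by `2 * t` attributes, but a
deterministic search needs depth `2 ^ t` (`exists_table_of_shattered`). For an irreducible
annihilating word the task is to name an attribute violating it: one query certifies the answer,
while an adversary concedes one attribute per query (`exists_table_of_annihilating`). For an
irreducible cover the task is to name a word covering the row: every word is the only correct answer
for some row, so a binary tree needs as many terminal decisions as there are words
(`exists_table_of_cover`).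

Sufficiency (`detComplexity_le_of_bounds`): the words of an optimal nondeterministic tree contain an
irreducible cover, so `L` bounds the number of attributes `B` that matter by a power of two with
polynomial exponent. Restricted to `B`, all attributes have complexity at most `n`; `Z` and the
Sauer–Shelah bound limit the number of rows to a power of two with polynomial exponent. A halving
strategy (`Node.exists_solves`) then finds a decision: form the majority assignment on `B`, and
query either a certificate of a row realizing it or, if there is no such row, a short set of
attributes refuting it, which `G` supplies. Every unexpected answer discards at least half of the
candidates, and each round costs polynomially many queries. -/

/-- The assignment that is `1` exactly on `a` satisfies all letters of the word `α`. -/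
def Agrees (a : Finset ℕ) (α : Word 2) : Prop := ∀ p ∈ α, (p.2 = 1 ↔ p.1 ∈ a)

theorem agrees_nil (a : Finset ℕ) : Agrees a [] := by simp [Agrees]

theorem agrees_cons {a : Finset ℕ} {p : ℕ × Fin 2} {α : Word 2} :
    Agrees a (p :: α) ↔ (p.2 = 1 ↔ p.1 ∈ a) ∧ Agrees a α := by
  simp [Agrees]

theorem agrees_congr {a b : Finset ℕ} {α : Word 2} (h : ∀ p ∈ α, (p.1 ∈ a ↔ p.1 ∈ b)) :
    Agrees a α ↔ Agrees b α :=
  forall₂_congr fun p hp => by rw [h p hp]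

/-- The letter saying whether `f` belongs to `b`. -/
def letter (b : Finset ℕ) (f : ℕ) : ℕ × Fin 2 := (f, if f ∈ b then 1 else 0)

theorem letter_agrees {a b : Finset ℕ} {f : ℕ} :
    ((letter b f).2 = 1 ↔ (letter b f).1 ∈ a) ↔ (f ∈ b ↔ f ∈ a) := by
  by_cases h : f ∈ b <;> simp [letter, h]

theorem eq_letter {b : Finset ℕ} {p : ℕ × Fin 2} (h : p.2 = 1 ↔ p.1 ∈ b) : p = letter b p.1 := by
  rcases p with ⟨f, δ⟩
  simp only at h
  by_cases hf : f ∈ b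
  · simp [letter, hf, h]
  · have : δ ≠ 1 := fun h' => hf (h.1 h')
    simp only [letter, hf, if_false, Prod.mk.injEq, true_and]
    omega

/-! ### Tables as families of finite sets -/

namespace Table

theorem eq_empty_iff (T : Table 2) : T = empty 2 ↔ T.rows = [] := by
  constructor
  · rintro rfl; rfl
  · intro h
    ext1
    · exact T.cols_eq_nil_iff.2 h
    · exact h

/-- The set of attributes whose columns contain `1` in the row `l`. -/
def support (T : Table 2) (l : List (Fin 2)) : Finset ℕ :=
  T.attrs.filter fun f => (f, 1) ∈ T.cols.zip l

theorem support_subset (T : Table 2) (l : List (Fin 2)) : T.support l ⊆ T.attrs :=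
  Finset.filter_subset _ _

theorem mem_support {T : Table 2} {l : List (Fin 2)} {f : ℕ} :
    f ∈ T.support l ↔ (f, 1) ∈ T.cols.zip l := by
  simp only [support, Finset.mem_filter, attrs, List.mem_toFinset, and_iff_right_iff_imp]
  exact fun h => (List.of_mem_zip h).1

theorem zip_unique {T : Table 2} {l : List (Fin 2)} (hl : l.length = T.cols.length) {f : ℕ}
    {δ σ : Fin 2} (h : (f, δ) ∈ T.cols.zip l) (h' : (f, σ) ∈ T.cols.zip l) : δ = σ := by
  have hn : ((T.cols.zip l).map Prod.fst).Nodup := by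
    rw [List.map_fst_zip hl.ge]; exact T.cols_nodup
  have := List.inj_on_of_nodup_map hn h h' rfl
  simpa using this

theorem mem_zip_iff {T : Table 2} {l : List (Fin 2)} (hl : l.length = T.cols.length) {f : ℕ}
    {δ : Fin 2} : (f, δ) ∈ T.cols.zip l ↔ f ∈ T.attrs ∧ (δ = 1 ↔ f ∈ T.support l) := by
  constructor
  · intro h
    refine ⟨by simpa [attrs] using (List.of_mem_zip h).1, ?_⟩
    rw [mem_support]
    exact ⟨fun h1 => h1 ▸ h, fun h1 => zip_unique hl h h1⟩
  · rintro ⟨hf, h⟩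
    have hf' : f ∈ (T.cols.zip l).map Prod.fst := by
      rw [List.map_fst_zip hl.ge]; simpa [attrs] using hf
    obtain ⟨⟨f', σ⟩, hσ, rfl⟩ := List.mem_map.1 hf'
    rw [mem_support] at h
    by_cases hδ : δ = 1
    · exact hδ ▸ h.1 hδ
    · have : σ ≠ 1 := fun h1 => hδ (h.2 (h1 ▸ hσ))
      have : δ = σ := by omega
      exact this ▸ hσ

/-- Over a binary alphabet the positions of the ones determine the tuple; hence counting supports
counts rows. -/
theorem support_inj {T : Table 2} {l l' : List (Fin 2)} (hl : l.length = T.cols.length)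
    (hl' : l'.length = T.cols.length) (h : T.support l = T.support l') : l = l' := by
  refine List.ext_getElem (hl.trans hl'.symm) fun i h1 h2 => ?_
  have hi : i < T.cols.length := hl ▸ h1
  have m1 : (T.cols[i], l[i]) ∈ T.cols.zip l := by
    rw [← List.getElem_zip (h := by simp; omega)]; exact List.getElem_mem _
  have m2 : (T.cols[i], l'[i]) ∈ T.cols.zip l' := by
    rw [← List.getElem_zip (h := by simp; omega)]; exact List.getElem_mem _
  rw [mem_zip_iff hl, h, ← mem_zip_iff hl'] at m1
  exact zip_unique hl' m1 m2

theorem forall_mem_zip_iff {T : Table 2} {l : List (Fin 2)} (hl : l.length = T.cols.length)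
    {α : Word 2} (hα : T.IsWord α) :
    (∀ a ∈ α, a ∈ T.cols.zip l) ↔ Agrees (T.support l) α := by
  refine forall₂_congr fun a ha => ?_
  rw [mem_zip_iff hl (f := a.1) (δ := a.2)]
  simp [hα a ha]

/-- The family of supports of the rows. -/
def supports (T : Table 2) : Finset (Finset ℕ) := T.tuples.image T.support

theorem mem_supports {T : Table 2} {a : Finset ℕ} :
    a ∈ T.supports ↔ ∃ r ∈ T.rows, T.support r.1 = a := by
  simp only [supports, tuples, Finset.mem_image, List.mem_toFinset, List.mem_map]
  constructor
  · rintro ⟨_, ⟨r, hr, rfl⟩, h⟩; exact ⟨r, hr, h⟩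
  · rintro ⟨r, hr, h⟩; exact ⟨_, ⟨r, hr, rfl⟩, h⟩

theorem subset_attrs_of_mem_supports {T : Table 2} {a : Finset ℕ} (h : a ∈ T.supports) :
    a ⊆ T.attrs := by
  obtain ⟨r, -, rfl⟩ := mem_supports.1 h
  exact T.support_subset _

theorem card_supports (T : Table 2) : T.supports.card = T.rows.length := by
  rw [supports, Finset.card_image_of_injOn, tuples, List.toFinset_card_of_nodup T.rows_nodup,
    List.length_map]
  intro l hl l' hl' h
  simp only [tuples, List.coe_toFinset, List.mem_map, Set.mem_ofPred_eq] at hl hl'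
  obtain ⟨r, hr, rfl⟩ := hl
  obtain ⟨r', hr', rfl⟩ := hl'
  exact support_inj (T.rows_length r hr) (T.rows_length r' hr') h

theorem attrs_nonempty {T : Table 2} (hT : T ≠ empty 2) : T.attrs.Nonempty := by
  rw [Finset.nonempty_iff_ne_empty, attrs, Ne, List.toFinset_eq_empty_iff, T.cols_eq_nil_iff,
    ← eq_empty_iff]
  exact hT

theorem supports_nonempty {T : Table 2} (hT : T ≠ empty 2) : T.supports.Nonempty := by
  rw [← Finset.card_pos, card_supports, List.length_pos_iff]
  exact fun h => hT (T.eq_empty_iff.2 h)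

theorem subtable_rows (T : Table 2) (α : Word 2) :
    (T.subtable α).rows = T.rows.filter fun r => ∀ a ∈ α, a ∈ T.cols.zip r.1 := by
  unfold subtable build
  split_ifs with h
  · rfl
  · rw [not_and_or, not_not, not_not] at h
    rcases h with h | h
    · rw [T.cols_eq_nil_iff.1 h]; rfl
    · rw [h]; rfl

theorem mem_subtable_rows {T : Table 2} {α : Word 2} (hα : T.IsWord α) {r : Row 2} :
    r ∈ (T.subtable α).rows ↔ r ∈ T.rows ∧ Agrees (T.support r.1) α := by
  rw [subtable_rows, List.mem_filter, decide_eq_true_iff]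
  exact and_congr_right fun hr => forall_mem_zip_iff (T.rows_length r hr) hα

theorem subtable_eq_empty_iff {T : Table 2} {α : Word 2} (hα : T.IsWord α) :
    T.subtable α = empty 2 ↔ ∀ a ∈ T.supports, ¬ Agrees a α := by
  rw [eq_empty_iff, List.eq_nil_iff_forall_not_mem]
  constructor
  · intro h a ha hag
    obtain ⟨r, hr, rfl⟩ := mem_supports.1 ha
    exact h r ((mem_subtable_rows hα).2 ⟨hr, hag⟩)
  · intro h r hr
    obtain ⟨hr, hag⟩ := (mem_subtable_rows hα).1 hr
    exact h _ (mem_supports.2 ⟨r, hr, rfl⟩) hag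

theorem mem_subtable_tuples {T : Table 2} {α : Word 2} (hα : T.IsWord α) {l : List (Fin 2)} :
    l ∈ (T.subtable α).tuples ↔ l ∈ T.tuples ∧ Agrees (T.support l) α := by
  simp only [tuples, List.mem_toFinset, List.mem_map]
  constructor
  · rintro ⟨r, hr, rfl⟩
    obtain ⟨hr, h⟩ := (mem_subtable_rows hα).1 hr
    exact ⟨⟨r, hr, rfl⟩, h⟩
  · rintro ⟨⟨r, hr, rfl⟩, h⟩
    exact ⟨r, (mem_subtable_rows hα).2 ⟨hr, h⟩, rfl⟩

theorem exists_mem_keepFirst {l : List (Row 2)} {r : Row 2} (h : r ∈ l) :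
    ∃ s ∈ keepFirst l, s.1 = r.1 := by
  induction l with
  | nil => simp at h
  | cons a l ih =>
    by_cases hra : r.1 = a.1
    · exact ⟨a, by simp [keepFirst], hra.symm⟩
    · rcases List.mem_cons.1 h with rfl | h
      · exact absurd rfl hra
      · obtain ⟨s, hs, hsr⟩ := ih h
        exact ⟨s, by simp [keepFirst, hs, hsr, hra], hsr⟩

theorem zip_removeEntries {T : Table 2} {D : Finset ℕ} {r : Row 2}
    (h : r.1.length = T.cols.length) :
    (T.cols.filter fun f => f ∉ D).zip (removeEntries T.cols D r).1 =
      (T.cols.zip r.1).filter fun a => a.1 ∉ D := by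
  have : T.cols = (T.cols.zip r.1).map Prod.fst := by rw [List.map_fst_zip h.ge]
  have h2 : (T.cols.filter fun f => f ∉ D) =
      ((T.cols.zip r.1).filter fun a => a.1 ∉ D).map Prod.fst := by
    conv_lhs => rw [this]
    rw [List.filter_map]; rfl
  rw [h2, removeEntries, List.zip_map', List.map_id'']
  intro x; rfl

/-- Any nonempty set `S` of attributes of `T` and any decisions give a table from `[T]` whose
rows are the restrictions to `S` of the rows of `T`. -/
theorem exists_mem_closure {T : Table 2} (hT : T ≠ empty 2) {S : Finset ℕ} (hS : S.Nonempty)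
    (hST : S ⊆ T.attrs) (dec : Finset ℕ → Finset ℕ)
    (hdec : ∀ a ∈ T.supports, (dec (a ∩ S)).Nonempty) :
    ∃ Q ∈ T.closure, Q ≠ empty 2 ∧ Q.attrs = S ∧ Q.supports = T.supports.image (· ∩ S) ∧
      ∀ r ∈ Q.rows, r.2.1 = dec (Q.support r.1) := by
  classical
  set D := T.attrs \ S with hD
  have hcols : (T.cols.filter fun f => f ∉ D).toFinset = S := by
    ext f
    have : f ∈ S → f ∈ T.cols := fun h => by simpa [attrs] using hST h
    simp only [hD, attrs, List.mem_toFinset, List.mem_filter, Finset.mem_sdiff, decide_eq_true_eq]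
    tauto
  have hc : (T.cols.filter fun f => f ∉ D) ≠ [] := by
    intro h
    rw [h] at hcols
    simp [← hcols] at hS
  have hr : keepFirst (T.rows.map (removeEntries T.cols D)) ≠ [] := by
    obtain ⟨r, hr⟩ := List.exists_mem_of_ne_nil _ fun h => hT (T.eq_empty_iff.2 h)
    obtain ⟨s, hs, -⟩ := exists_mem_keepFirst (List.mem_map_of_mem (f := removeEntries T.cols D) hr)
    exact List.ne_nil_of_mem hs
  have hRc : (removeColumns D T).cols = T.cols.filter fun f => f ∉ D := by
    unfold removeColumns build
    rw [dif_pos ⟨hc, hr⟩]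
  have hRr : (removeColumns D T).rows = keepFirst (T.rows.map (removeEntries T.cols D)) := by
    unfold removeColumns build
    rw [dif_pos ⟨hc, hr⟩]
  -- The default `{0}` is never used on a row of the restricted table: by `hdec` the first branch
  -- applies there. All decisions are overwritten, so it does not matter which row of a merged group
  -- was kept.
  let ν : List (Fin 2) → DecisionSet := fun l =>
    if h : (dec ((removeColumns D T).support l)).Nonempty then ⟨_, h⟩
    else ⟨{0}, Finset.singleton_nonempty 0⟩
  have hsup : ∀ l, (changeDecisions ν (removeColumns D T)).support l =
      (removeColumns D T).support l := fun l => rfl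
  have hsup2 : ∀ r ∈ T.rows, (removeColumns D T).support (removeEntries T.cols D r).1 =
      T.support r.1 ∩ S := by
    intro r hr
    ext f
    rw [mem_support, hRc, zip_removeEntries (T.rows_length r hr), List.mem_filter, ← mem_support]
    have : f ∈ T.support r.1 → f ∈ T.attrs := fun h => T.support_subset _ h
    simp only [hD, Finset.mem_sdiff, Finset.mem_inter, decide_eq_true_eq]
    tauto
  have hrows : ∀ r ∈ (removeColumns D T).rows, ∃ s ∈ T.rows, r.1 = (removeEntries T.cols D s).1 := by
    intro r hr
    rw [hRr] at hr
    obtain ⟨s, hs, rfl⟩ := List.mem_map.1 (mem_of_mem_keepFirst hr)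
    exact ⟨s, hs, rfl⟩
  refine ⟨changeDecisions ν (removeColumns D T), ⟨D, Finset.sdiff_subset, ν, rfl⟩, ?_, ?_, ?_, ?_⟩
  · rw [Ne, eq_empty_iff]
    simp [changeDecisions, hRr, hr]
  · change (removeColumns D T).cols.toFinset = S
    rw [hRc, hcols]
  · ext a
    simp only [mem_supports, Finset.mem_image, changeDecisions, List.mem_map]
    constructor
    · rintro ⟨_, ⟨r, hr, rfl⟩, rfl⟩
      obtain ⟨s, hs, hrs⟩ := hrows r hr
      refine ⟨_, ⟨s, hs, rfl⟩, ?_⟩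
      rw [← hsup2 s hs, ← hrs]
      rfl
    · rintro ⟨_, ⟨s, hs, rfl⟩, rfl⟩
      obtain ⟨r, hr, hrs⟩ :=
        exists_mem_keepFirst (List.mem_map_of_mem (f := removeEntries T.cols D) hs)
      rw [← hRr] at hr
      refine ⟨_, ⟨r, hr, rfl⟩, ?_⟩
      rw [← hsup2 s hs, ← hrs]
      rfl
  · intro q hq
    obtain ⟨r, hr, rfl⟩ := List.mem_map.1 hq
    obtain ⟨s, hs, hrs⟩ := hrows r hr
    have h : (dec ((removeColumns D T).support r.1)).Nonempty := by
      rw [hrs, hsup2 s hs]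
      exact hdec _ (mem_supports.2 ⟨s, hs, rfl⟩)
    simp only [hsup, ν, dif_pos h]

end Table

theorem IsClosedClass.closure_subset {A : Set (Table 2)} (hA : IsClosedClass A) {T Q : Table 2}
    (hT : T ∈ A) (hQ : Q ∈ T.closure) : Q ∈ A := by
  rw [← hA.2]
  exact Set.mem_biUnion hT hQ

/-! ### Deterministic trees built by halving -/

namespace Node

theorem mem_paths_query {f n : ℕ} {label : Fin (n + 1) → Fin 2} {child : Fin (n + 1) → Node 2}
    {p : Word 2 × ℕ} : p ∈ (query f n label child).paths ↔
      ∃ i, ∃ q ∈ (child i).paths, ((f, label i) :: q.1, q.2) = p := by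
  simp [paths]

theorem mem_paths_terminal {d : ℕ} {p : Word 2 × ℕ} :
    p ∈ (terminal d : Node 2).paths ↔ p = ([], d) := by
  simp [paths]

theorem paths_nonempty (N : Node 2) : N.paths.Nonempty := by
  induction N with
  | terminal d => exact ⟨_, mem_paths_terminal.2 rfl⟩
  | query f n label child ih =>
    obtain ⟨q, hq⟩ := ih 0
    exact ⟨_, mem_paths_query.2 ⟨0, q, hq, rfl⟩⟩

theorem fst_mem_attrs {N : Node 2} {p : Word 2 × ℕ} (hp : p ∈ N.paths) :
    ∀ a ∈ p.1, a.1 ∈ N.attrs := by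
  induction N generalizing p with
  | terminal d =>
    rw [mem_paths_terminal] at hp
    simp [hp]
  | query f n label child ih =>
    obtain ⟨i, q, hq, rfl⟩ := mem_paths_query.1 hp
    intro a ha
    simp only [attrs, Finset.mem_insert, Finset.mem_biUnion, Finset.mem_univ, true_and]
    rcases List.mem_cons.1 ha with rfl | ha
    · exact Or.inl rfl
    · exact Or.inr ⟨i, ih i hq a ha⟩

/-- A single path that spells the word `α` and ends with the decision `d`. -/
def chain (d : ℕ) : Word 2 → Node 2
  | [] => terminal d
  | p :: α => query p.1 0 (fun _ => p.2) fun _ => chain d α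

theorem paths_chain (d : ℕ) (α : Word 2) : (chain d α).paths = {(α, d)} := by
  induction α with
  | nil => simp [chain, paths]
  | cons p α ih => simp [chain, paths, ih]

theorem attrs_chain (d : ℕ) (α : Word 2) : (chain d α).attrs = (α.map Prod.fst).toFinset := by
  induction α with
  | nil => simp [chain, attrs]
  | cons p α ih => simp [chain, attrs, ih]

/-- A node with two leaving edges. -/
def branch (f : ℕ) (child : Fin 2 → Node 2) : Node 2 := query f 1 id child

/-- `N` computes deterministically, in at most `L` queries of attributes from `B`, for each
assignment from `F` the decision of a pair from `W` whose word agrees with the assignment. -/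
structure Solves (N : Node 2) (B : Finset ℕ) (F : Finset (Finset ℕ)) (W : Finset (Word 2 × ℕ))
    (L : ℕ) : Prop where
  det : N.IsDeterministic
  attrs_subset : N.attrs ⊆ B
  length_le : ∀ p ∈ N.paths, p.1.length ≤ L
  covers : ∀ a, ∃ p ∈ N.paths, Agrees a p.1
  sound : ∀ p ∈ N.paths, ∀ a ∈ F, Agrees a p.1 → ∃ w ∈ W, w.2 = p.2 ∧ Agrees a w.1

theorem Solves.mono {N : Node 2} {B : Finset ℕ} {F F' : Finset (Finset ℕ)}
    {W : Finset (Word 2 × ℕ)} {L L' : ℕ} (h : N.Solves B F W L) (hF : F' ⊆ F) (hL : L ≤ L') :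
    N.Solves B F' W L' :=
  ⟨h.det, h.attrs_subset, fun p hp => (h.length_le p hp).trans hL, h.covers,
    fun p hp a ha => h.sound p hp a (hF ha)⟩

theorem solves_terminal {B : Finset ℕ} {F : Finset (Finset ℕ)} {W : Finset (Word 2 × ℕ)}
    {d : ℕ} (L : ℕ) (hd : ∀ a ∈ F, ∃ w ∈ W, w.2 = d ∧ Agrees a w.1) :
    (terminal d).Solves B F W L := by
  refine ⟨trivial, by simp [attrs], ?_, fun a => ⟨_, mem_paths_terminal.2 rfl, agrees_nil a⟩, ?_⟩
  · intro p hp; simp [mem_paths_terminal.1 hp]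
  · intro p hp a ha _; rw [mem_paths_terminal.1 hp]; exact hd a ha

/-- Both edges are present, so every assignment follows some path, while soundness at a child is
only needed for the candidates consistent with the answer. -/
theorem solves_branch {B : Finset ℕ} {F : Finset (Finset ℕ)} {W : Finset (Word 2 × ℕ)} {L f : ℕ}
    (hf : f ∈ B) {child : Fin 2 → Node 2}
    (h : ∀ i, (child i).Solves B (F.filter fun a => (i = 1 ↔ f ∈ a)) W L) :
    (branch f child).Solves B F W (L + 1) := by
  refine ⟨⟨Function.injective_id, fun i => (h i).det⟩, ?_, ?_, ?_, ?_⟩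
  · intro g hg
    simp only [branch, attrs, Finset.mem_insert, Finset.mem_biUnion, Finset.mem_univ,
      true_and] at hg
    rcases hg with rfl | ⟨i, hi⟩
    · exact hf
    · exact (h i).attrs_subset hi
  · intro p hp
    obtain ⟨i, q, hq, rfl⟩ := mem_paths_query.1 hp
    simpa using (h i).length_le q hq
  · intro a
    obtain ⟨q, hq, hqa⟩ := (h (letter a f).2).covers a
    exact ⟨_, mem_paths_query.2 ⟨(letter a f).2, q, hq, rfl⟩,
      agrees_cons.2 ⟨(letter_agrees (a := a) (b := a) (f := f)).2 Iff.rfl, hqa⟩⟩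
  · intro p hp a ha hag
    obtain ⟨i, q, hq, rfl⟩ := mem_paths_query.1 hp
    obtain ⟨h1, h2⟩ := agrees_cons.1 hag
    exact (h i).sound q hq a (Finset.mem_filter.2 ⟨ha, h1⟩) h2

/-- The attributes of the word `u` are asked one after another until an answer differs from
`u`. -/
theorem exists_solves_of_word {B : Finset ℕ} {W : Finset (Word 2 × ℕ)} {L d : ℕ} (u : Word 2)
    (hu : ∀ p ∈ u, p.1 ∈ B) (F : Finset (Finset ℕ))
    (h : ∀ p ∈ u, ∃ N : Node 2, N.Solves B (F.filter fun a => ¬ (p.2 = 1 ↔ p.1 ∈ a)) W L)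
    (hd : ∀ a ∈ F, Agrees a u → ∃ w ∈ W, w.2 = d ∧ Agrees a w.1) :
    ∃ N : Node 2, N.Solves B F W (u.length + L) := by
  induction u generalizing F with
  | nil => exact ⟨terminal d, solves_terminal _ fun a ha => hd a ha (agrees_nil a)⟩
  | cons p u ih =>
    obtain ⟨N, hN⟩ := h p List.mem_cons_self
    obtain ⟨N', hN'⟩ := ih (fun q hq => hu q (List.mem_cons_of_mem _ hq))
      (F.filter fun a => (p.2 = 1 ↔ p.1 ∈ a))
      (fun q hq => by
        obtain ⟨N, hN⟩ := h q (List.mem_cons_of_mem _ hq)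
        exact ⟨N, hN.mono (Finset.filter_subset_filter _ (Finset.filter_subset _ _)) le_rfl⟩)
      (fun a ha hag => by
        obtain ⟨ha, hap⟩ := Finset.mem_filter.1 ha
        exact hd a ha (agrees_cons.2 ⟨hap, hag⟩))
    -- The expected answer continues along `u`; the other answer leaves for the tree handling the
    -- assignments that contradict `p`.
    refine ⟨branch p.1 fun i => if i = p.2 then N' else N,
      (solves_branch (L := u.length + L) (hu p List.mem_cons_self) fun i => ?_).mono subset_rfl
        (by rw [List.length_cons]; omega)⟩
    by_cases hi : i = p.2
    · simpa only [hi, if_true] using hN'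
    · rw [if_neg hi]
      refine hN.mono (fun a ha => ?_) (by omega)
      obtain ⟨ha, hai⟩ := Finset.mem_filter.1 ha
      refine Finset.mem_filter.2 ⟨ha, fun h' => ?_⟩
      have : i = 1 ↔ p.2 = 1 := hai.trans h'.symm
      omega

/-- Every round of at most `K` queries halves the set of possible assignments. -/
theorem exists_solves {B : Finset ℕ} {X : Finset (Finset ℕ)} {W : Finset (Word 2 × ℕ)} {K : ℕ}
    (hW : ∀ a ∈ X, ∃ w ∈ W, Agrees a w.1) (hWB : ∀ w ∈ W, ∀ p ∈ w.1, p.1 ∈ B)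
    (hWK : ∀ w ∈ W, w.1.length ≤ K)
    (hK : ∀ b ⊆ B, (∀ a ∈ X, a ∩ B ≠ b) → ∃ S ⊆ B, S.card ≤ K ∧ ∀ a ∈ X, a ∩ S ≠ b ∩ S)
    (k : ℕ) (F : Finset (Finset ℕ)) (hFX : F ⊆ X) (hF : F.card < 2 ^ k) :
    ∃ N : Node 2, N.Solves B F W (K * k) := by
  induction k generalizing F with
  | zero =>
    -- The strict bound `F.card < 2 ^ k` makes the base case empty, so the decision at the terminal
    -- node is arbitrary.
    have : F = ∅ := by simpa using hF
    exact ⟨terminal 0, solves_terminal _ (by simp [this])⟩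
  | succ k ih =>
    -- The majority vote of `F` on each attribute of `B`: an answer that contradicts `b` leaves at
    -- most half of `F`.
    set b := B.filter fun f => F.card < 2 * (F.filter fun a => f ∈ a).card with hb
    have hmin : ∀ f ∈ B, ∃ N : Node 2, N.Solves B
        (F.filter fun a => ¬ ((letter b f).2 = 1 ↔ (letter b f).1 ∈ a)) W (K * k) := by
      intro f hf
      refine ih _ ((Finset.filter_subset _ _).trans hFX) ?_
      simp only [letter_agrees]
      have hc := Finset.card_filter_add_card_filter_not (s := F) (fun a => f ∈ a)
      by_cases hfb : f ∈ b
      · have h1 := (Finset.mem_filter.1 hfb).2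
        simp only [hfb, true_iff]
        rw [pow_succ] at hF
        omega
      · have h1 : ¬ F.card < 2 * (F.filter fun a => f ∈ a).card :=
          fun h => hfb (Finset.mem_filter.2 ⟨hf, h⟩)
        simp only [hfb, false_iff, not_not]
        rw [pow_succ] at hF
        omega
    -- If a row realizes the majority assignment, querying its certificate either confirms a
    -- decision or halves `F`.
    by_cases hbX : ∃ a ∈ X, a ∩ B = b
    · obtain ⟨a, ha, hab⟩ := hbX
      obtain ⟨w, hw, hwa⟩ := hW a ha
      obtain ⟨N, hN⟩ := exists_solves_of_word (d := w.2) w.1 (hWB w hw) F (fun p hp => by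
        have hpb : p = letter b p.1 := eq_letter (by
          rw [hwa p hp, ← hab, Finset.mem_inter, and_iff_left (hWB w hw p hp)])
        rw [hpb]
        exact hmin _ (hWB w hw p hp)) (fun a ha h => ⟨w, hw, rfl, h⟩)
      refine ⟨N, hN.mono subset_rfl ?_⟩
      have := hWK w hw
      rw [mul_add]
      omega
    -- No row matches `b` on `S`, so one of the answers on `S` must contradict the majority; the
    -- path where all agree is vacuous and its decision `0` is a dummy.
    · obtain ⟨S, hSB, hSK, hS⟩ := hK b (Finset.filter_subset _ _) (by push Not at hbX; exact hbX)
      obtain ⟨N, hN⟩ := exists_solves_of_word (d := 0) (S.toList.map (letter b))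
        (fun p hp => by
          obtain ⟨f, hf, rfl⟩ := List.mem_map.1 hp
          exact hSB (Finset.mem_toList.1 hf)) F
        (fun p hp => by
          obtain ⟨f, hf, rfl⟩ := List.mem_map.1 hp
          exact hmin f (hSB (Finset.mem_toList.1 hf)))
        (fun a ha h => by
          refine absurd ?_ (hS a (hFX ha))
          ext f
          simp only [Finset.mem_inter]
          refine and_congr_left fun hf => ?_
          have := h _ (List.mem_map_of_mem (Finset.mem_toList.2 hf))
          rw [letter_agrees] at this
          exact this.symm)
      refine ⟨N, hN.mono subset_rfl ?_⟩
      rw [mul_add, List.length_map, Finset.length_toList]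
      omega

end Node

/-! ### Decision trees for tables and their complexities -/

theorem Tree.fst_mem_attrs {Γ : Tree 2} {p : Word 2 × ℕ} (hp : p ∈ Γ.paths) :
    ∀ a ∈ p.1, a.1 ∈ Γ.attrs := by
  intro a ha
  obtain ⟨i, -, hi⟩ := Finset.mem_biUnion.1 hp
  exact Finset.mem_biUnion.2 ⟨i, Finset.mem_univ i, Node.fst_mem_attrs hi a ha⟩

theorem Tree.isNondeterministicFor_iff {Γ : Tree 2} {T : Table 2} :
    Γ.IsNondeterministicFor T ↔ Γ.attrs ⊆ T.attrs ∧
      (∀ r ∈ T.rows, ∃ p ∈ Γ.paths, Agrees (T.support r.1) p.1) ∧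
      ∀ p ∈ Γ.paths, ∀ r ∈ T.rows, Agrees (T.support r.1) p.1 → p.2 ∈ r.2.1 := by
  refine and_congr_right fun hΓ => ?_
  have hw : ∀ p ∈ Γ.paths, T.IsWord p.1 := fun p hp a ha => hΓ (Tree.fst_mem_attrs hp a ha)
  refine and_congr ?_ (forall₂_congr fun p hp => ?_)
  · constructor
    · intro h r hr
      obtain ⟨p, hp, hrp⟩ := h r.1 (List.mem_toFinset.2 (List.mem_map_of_mem hr))
      exact ⟨p, hp, ((Table.mem_subtable_tuples (hw p hp)).1 hrp).2⟩
    · intro h l hl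
      obtain ⟨r, hr, rfl⟩ : ∃ r ∈ T.rows, r.1 = l := by simpa [Table.tuples] using hl
      obtain ⟨p, hp, hrp⟩ := h r hr
      exact ⟨p, hp, (Table.mem_subtable_tuples (hw p hp)).2 ⟨hl, hrp⟩⟩
  · constructor
    · intro h r hr hrp
      have hrs := (Table.mem_subtable_rows (hw p hp)).2 ⟨hr, hrp⟩
      rcases h with h | h
      · rw [(Table.eq_empty_iff _).1 h] at hrs
        simp at hrs
      · exact h r hrs
    · intro h
      right
      intro r hr
      obtain ⟨hr, hrp⟩ := (Table.mem_subtable_rows (hw p hp)).1 hr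
      exact h r hr hrp

variable {ψ : List ℕ → ℕ}

theorem IsBoundedMeasure.wordComplexity_le (hψ : IsBoundedMeasure ψ) {α : Word 2} {n : ℕ}
    (h : ∀ p ∈ α, ψ [p.1] ≤ n) : wordComplexity ψ α ≤ n * α.length := by
  induction α with
  | nil => simp [wordComplexity, (hψ.eq_zero_iff []).2 rfl]
  | cons p α ih =>
    have h1 := ih fun q hq => h q (List.mem_cons_of_mem _ hq)
    have h2 := hψ.append_le [p.1] (α.map Prod.fst)
    have h3 := h p List.mem_cons_self
    simp only [wordComplexity, List.map_cons, List.length_cons, mul_add] at h1 ⊢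
    simp only [List.singleton_append] at h2
    omega

theorem IsBoundedMeasure.length_le_wordComplexity (hψ : IsBoundedMeasure ψ) (α : Word 2) :
    α.length ≤ wordComplexity ψ α := by
  simpa [wordComplexity] using hψ.length_le (α.map Prod.fst)

theorem IsBoundedMeasure.letter_le (hψ : IsBoundedMeasure ψ) {α : Word 2} {p : ℕ × Fin 2}
    (hp : p ∈ α) : ψ [p.1] ≤ wordComplexity ψ α := by
  obtain ⟨s, t, rfl⟩ := List.append_of_mem hp
  have h1 := hψ.le_append [p.1] (s.map Prod.fst ++ t.map Prod.fst)
  have h2 := hψ.perm ([p.1] ++ (s.map Prod.fst ++ t.map Prod.fst))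
    ((s ++ p :: t).map Prod.fst) (by simpa using List.perm_middle.symm)
  rw [wordComplexity, ← h2]
  exact h1

theorem le_maxAttrComplexity {T : Table 2} {f : ℕ} (hf : f ∈ T.attrs) :
    ψ [f] ≤ maxAttrComplexity ψ T :=
  Finset.le_sup (f := fun f => ψ [f]) hf

theorem wordComplexity_le_treeComplexity {Γ : Tree 2} {p : Word 2 × ℕ} (hp : p ∈ Γ.paths) :
    wordComplexity ψ p.1 ≤ treeComplexity ψ Γ :=
  Finset.le_sup (f := fun p : Word 2 × ℕ => wordComplexity ψ p.1) hp

/-- A nondeterministic decision tree may be given by one word for each row. -/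
theorem exists_nondeterministic {T : Table 2} (hT : T ≠ Table.empty 2) {n : ℕ}
    (h : ∀ r ∈ T.rows, ∃ (α : Word 2) (d : ℕ), T.IsWord α ∧ wordComplexity ψ α ≤ n ∧
      Agrees (T.support r.1) α ∧ ∀ s ∈ T.rows, Agrees (T.support s.1) α → d ∈ s.2.1) :
    ∃ Γ : Tree 2, Γ.IsNondeterministicFor T ∧ treeComplexity ψ Γ ≤ n := by
  choose! α d hα hn hag hd using h
  obtain ⟨m, hm⟩ : ∃ m, T.rows.length = m + 1 :=
    Nat.exists_eq_succ_of_ne_zero fun h0 => hT (T.eq_empty_iff.2 (List.length_eq_zero_iff.1 h0))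
  have hmem : ∀ p, p ∈ Tree.paths ⟨m, fun i => Node.chain (d (T.rows.get (i.cast hm.symm)))
      (α (T.rows.get (i.cast hm.symm)))⟩ ↔ ∃ r ∈ T.rows, p = (α r, d r) := by
    intro p
    simp only [Tree.paths, Node.paths_chain, Finset.mem_biUnion, Finset.mem_univ, true_and,
      Finset.mem_singleton]
    constructor
    · rintro ⟨i, hi⟩
      exact ⟨_, List.get_mem _ _, hi⟩
    · rintro ⟨r, hr, hp⟩
      obtain ⟨i, rfl⟩ := List.get_of_mem hr
      exact ⟨i.cast hm, hp⟩
  refine ⟨⟨m, fun i => Node.chain (d (T.rows.get (i.cast hm.symm)))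
    (α (T.rows.get (i.cast hm.symm)))⟩, Tree.isNondeterministicFor_iff.2 ⟨?_, ?_, ?_⟩, ?_⟩
  · intro f hf
    obtain ⟨i, -, hi⟩ := Finset.mem_biUnion.1 hf
    rw [Node.attrs_chain, List.mem_toFinset, List.mem_map] at hi
    obtain ⟨p, hp, rfl⟩ := hi
    exact hα _ (List.get_mem _ _) p hp
  · intro r hr
    exact ⟨_, (hmem _).2 ⟨r, hr, rfl⟩, hag r hr⟩
  · intro p hp s hs hsp
    obtain ⟨r, hr, rfl⟩ := (hmem p).1 hp
    exact hd r hr s hs hsp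
  · refine Finset.sup_le fun p hp => ?_
    obtain ⟨r, hr, rfl⟩ := (hmem p).1 hp
    exact hn r hr

theorem nondetComplexity_le {T : Table 2} (hT : T ≠ Table.empty 2) {n : ℕ}
    (h : ∀ r ∈ T.rows, ∃ (α : Word 2) (d : ℕ), T.IsWord α ∧ wordComplexity ψ α ≤ n ∧
      Agrees (T.support r.1) α ∧ ∀ s ∈ T.rows, Agrees (T.support s.1) α → d ∈ s.2.1) :
    nondetComplexity ψ T ≤ n := by
  obtain ⟨Γ, hΓ, hn⟩ := exists_nondeterministic hT h
  rw [nondetComplexity, if_neg hT]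
  refine le_trans (Nat.sInf_le ?_) hn
  exact ⟨Γ, hΓ, rfl⟩

theorem mem_letters_agrees {T : Table 2} {a b : Finset ℕ} (ha : a ⊆ T.attrs) (hb : b ⊆ T.attrs)
    (h : Agrees a (T.cols.map (letter b))) : a = b := by
  ext f
  by_cases hf : f ∈ T.attrs
  · have := h _ (List.mem_map_of_mem (by simpa [Table.attrs] using hf))
    rw [letter_agrees] at this
    exact this.symm
  · exact ⟨fun h => absurd (ha h) hf, fun h => absurd (hb h) hf⟩

/-- The infimum of an empty set of naturals is `0`, so attainment needs some tree; one with a path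
spelling out each full row serves. -/
theorem exists_nondeterministic_eq {T : Table 2} (hT : T ≠ Table.empty 2) :
    ∃ Γ : Tree 2, Γ.IsNondeterministicFor T ∧ treeComplexity ψ Γ = nondetComplexity ψ T := by
  rw [nondetComplexity, if_neg hT]
  suffices h : {c | ∃ Γ : Tree 2, Γ.IsNondeterministicFor T ∧ treeComplexity ψ Γ = c}.Nonempty from
    Nat.sInf_mem h
  obtain ⟨Γ, hΓ, -⟩ := exists_nondeterministic (ψ := ψ) hT
    (n := T.supports.sup fun a => wordComplexity ψ (T.cols.map (letter a))) fun r hr => by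
      obtain ⟨d, hd⟩ := r.2.2
      refine ⟨T.cols.map (letter (T.support r.1)), d, ?_, ?_, ?_, ?_⟩
      · intro p hp
        obtain ⟨f, hf, rfl⟩ := List.mem_map.1 hp
        simpa [Table.attrs, letter] using hf
      · exact Finset.le_sup (f := fun a => wordComplexity ψ (T.cols.map (letter a)))
          (Table.mem_supports.2 ⟨r, hr, rfl⟩)
      · intro p hp
        obtain ⟨f, hf, rfl⟩ := List.mem_map.1 hp
        exact letter_agrees.2 Iff.rfl
      · intro s hs h
        have h1 := mem_letters_agrees (T.support_subset _) (T.support_subset _) h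
        have h2 := Table.support_inj (T.rows_length s hs) (T.rows_length r hr) h1
        have h3 := List.inj_on_of_nodup_map T.rows_nodup hs hr h2
        rwa [h3]
  exact ⟨_, Γ, hΓ, rfl⟩

/-- A deterministic tree for `T` obtained by halving. -/
theorem exists_deterministic (hψ : IsBoundedMeasure ψ) {T : Table 2} {B : Finset ℕ}
    (hBT : B ⊆ T.attrs) {W : Finset (Word 2 × ℕ)} {K n k : ℕ}
    (hn : ∀ f ∈ B, ψ [f] ≤ n)
    (hW : ∀ a ∈ T.supports, ∃ w ∈ W, Agrees a w.1) (hWB : ∀ w ∈ W, ∀ p ∈ w.1, p.1 ∈ B)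
    (hWT : ∀ w ∈ W, ∀ r ∈ T.rows, Agrees (T.support r.1) w.1 → w.2 ∈ r.2.1)
    (hWK : ∀ w ∈ W, w.1.length ≤ K)
    (hK : ∀ b ⊆ B, (∀ a ∈ T.supports, a ∩ B ≠ b) →
      ∃ S ⊆ B, S.card ≤ K ∧ ∀ a ∈ T.supports, a ∩ S ≠ b ∩ S)
    (hk : (T.supports.image (· ∩ B)).card < 2 ^ k) :
    ∃ Γ : Tree 2, Γ.IsDeterministicFor T ∧ treeComplexity ψ Γ ≤ n * (K * k) := by
  have hAg : ∀ (a : Finset ℕ) (α : Word 2), (∀ p ∈ α, p.1 ∈ B) →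
      (Agrees (a ∩ B) α ↔ Agrees a α) := fun a α h =>
    agrees_congr fun p hp => by rw [Finset.mem_inter, and_iff_left (h p hp)]
  obtain ⟨N, hN⟩ := Node.exists_solves (X := T.supports.image (· ∩ B)) (W := W) (B := B) (K := K)
    (by
      intro a' ha'
      obtain ⟨a, ha, rfl⟩ := Finset.mem_image.1 ha'
      obtain ⟨w, hw, hwa⟩ := hW a ha
      exact ⟨w, hw, (hAg a w.1 (hWB w hw)).2 hwa⟩) hWB hWK
    (by
      intro b hb h
      obtain ⟨S, hSB, hSK, hS⟩ := hK b hb fun a ha => by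
        simpa using h _ (Finset.mem_image_of_mem _ ha)
      refine ⟨S, hSB, hSK, fun a' ha' => ?_⟩
      obtain ⟨a, ha, rfl⟩ := Finset.mem_image.1 ha'
      rw [Finset.inter_assoc, Finset.inter_eq_right.2 hSB]
      exact hS a ha) k _ subset_rfl hk
  have hNB : ∀ p ∈ N.paths, ∀ q ∈ p.1, q.1 ∈ B := fun p hp q hq =>
    hN.attrs_subset (Node.fst_mem_attrs hp q hq)
  have hp : Tree.paths ⟨0, fun _ => N⟩ = N.paths := by
    ext p; simp [Tree.paths]
  refine ⟨⟨0, fun _ => N⟩, ⟨rfl, fun _ => hN.det, Tree.isNondeterministicFor_iff.2 ⟨?_, ?_, ?_⟩⟩,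
    Finset.sup_le fun p hpp => ?_⟩
  · intro f hf
    obtain ⟨i, -, hi⟩ := Finset.mem_biUnion.1 hf
    exact hBT (hN.attrs_subset hi)
  · intro r _
    rw [hp]
    exact hN.covers _
  · intro p hpp r hr hag
    rw [hp] at hpp
    have hr' : T.support r.1 ∈ T.supports := Table.mem_supports.2 ⟨r, hr, rfl⟩
    obtain ⟨w, hw, hwp, hwa⟩ := hN.sound p hpp _ (Finset.mem_image_of_mem _ hr')
      ((hAg _ _ (hNB p hpp)).2 hag)
    rw [← hwp]
    exact hWT w hw r hr ((hAg _ _ (hWB w hw)).1 hwa)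
  · rw [hp] at hpp
    exact (hψ.wordComplexity_le fun q hq => hn _ (hNB p hpp q hq)).trans
      (Nat.mul_le_mul_left _ (hN.length_le p hpp))

/-- As in the nondeterministic case, only the existence of a tree is at stake; halving with crude
parameters on all attributes provides one, and its complexity bound is discarded. -/
theorem exists_deterministic_eq (hψ : IsBoundedMeasure ψ) {T : Table 2}
    (hT : T ≠ Table.empty 2) :
    ∃ Γ : Tree 2, Γ.IsDeterministicFor T ∧ treeComplexity ψ Γ = detComplexity ψ T := by
  rw [detComplexity, if_neg hT]
  suffices h : {c | ∃ Γ : Tree 2, Γ.IsDeterministicFor T ∧ treeComplexity ψ Γ = c}.Nonempty from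
    Nat.sInf_mem h
  obtain ⟨Γ, hΓ, -⟩ := exists_nondeterministic_eq (ψ := ψ) hT
  obtain ⟨h1, h2, h3⟩ := Tree.isNondeterministicFor_iff.1 hΓ
  obtain ⟨Γ', hΓ', -⟩ := exists_deterministic hψ (T := T) (B := T.attrs) subset_rfl (W := Γ.paths)
    (K := max T.attrs.card (treeComplexity ψ Γ)) (n := maxAttrComplexity ψ T)
    (k := (T.supports.image (· ∩ T.attrs)).card) (fun f hf => le_maxAttrComplexity hf)
    (fun a ha => by
      obtain ⟨r, hr, rfl⟩ := Table.mem_supports.1 ha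
      exact h2 r hr)
    (fun w hw p hp => h1 (Tree.fst_mem_attrs hw p hp)) h3
    (fun w hw => ((hψ.length_le_wordComplexity w.1).trans
      (wordComplexity_le_treeComplexity hw)).trans (le_max_right _ _))
    (fun b hb h => ⟨T.attrs, subset_rfl, le_max_left _ _, fun a ha => by
      rw [Finset.inter_eq_left.2 hb]; exact h a ha⟩)
    Nat.lt_two_pow_self
  exact ⟨_, Γ', hΓ', rfl⟩

theorem detComplexity_le {T : Table 2} {c : ℕ}
    (h : ∃ Γ : Tree 2, Γ.IsDeterministicFor T ∧ treeComplexity ψ Γ ≤ c) :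
    detComplexity ψ T ≤ c := by
  obtain ⟨Γ, hΓ, hc⟩ := h
  rw [detComplexity]
  split_ifs
  · exact Nat.zero_le _
  · refine le_trans (Nat.sInf_le ?_) hc
    exact ⟨Γ, hΓ, rfl⟩

/-- A deterministic tree seen as one node: its paths cover the rows of `T`, give correct
decisions, and are not longer than `ψ^d(T)`. -/
theorem exists_deterministic_node (hψ : IsBoundedMeasure ψ) {T : Table 2}
    (hT : T ≠ Table.empty 2) :
    ∃ N : Node 2, N.IsDeterministic ∧ (∀ p ∈ N.paths, p.1.length ≤ detComplexity ψ T) ∧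
      (∀ r ∈ T.rows, ∃ p ∈ N.paths, Agrees (T.support r.1) p.1) ∧
      ∀ p ∈ N.paths, ∀ r ∈ T.rows, Agrees (T.support r.1) p.1 → p.2 ∈ r.2.1 := by
  obtain ⟨⟨m, child⟩, ⟨hm, hdet, hΓ⟩, hc⟩ := exists_deterministic_eq (ψ := ψ) hψ hT
  obtain ⟨-, h2, h3⟩ := Tree.isNondeterministicFor_iff.1 hΓ
  simp only at hm
  subst hm
  have hp : Tree.paths ⟨0, child⟩ = (child 0).paths := by
    ext p; simp [Tree.paths]
  rw [hp] at h2 h3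
  refine ⟨child 0, hdet 0, fun p hpp => ?_, h2, h3⟩
  rw [← hc]
  exact (hψ.length_le_wordComplexity p.1).trans
    (wordComplexity_le_treeComplexity (by rw [hp]; exact hpp))

/-! ### Adversary and counting lower bounds for deterministic trees -/

namespace Node

/-- Determinism over two labels allows at most two edges per node, so the terminal decisions at most
double per level. -/
theorem card_decisions_le (N : Node 2) (hN : N.IsDeterministic) (L : ℕ)
    (hL : ∀ p ∈ N.paths, p.1.length ≤ L) : (N.paths.image Prod.snd).card ≤ 2 ^ L := by
  induction N generalizing L with
  | terminal d => simpa [paths] using Nat.one_le_two_pow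
  | query f n label child ih =>
    obtain ⟨hinj, hdet⟩ := hN
    obtain ⟨q, hq⟩ := (child 0).paths_nonempty
    obtain ⟨L, rfl⟩ : ∃ L', L = L' + 1 := by
      have := hL _ (mem_paths_query.2 ⟨0, q, hq, rfl⟩)
      exact Nat.exists_eq_succ_of_ne_zero (by rintro rfl; simp at this)
    have hn : n + 1 ≤ 2 := by simpa using Fintype.card_le_of_injective _ hinj
    have hsub : (query f n label child).paths.image Prod.snd ⊆
        Finset.univ.biUnion fun i => (child i).paths.image Prod.snd := by
      intro d hd
      obtain ⟨p, hp, rfl⟩ := Finset.mem_image.1 hd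
      obtain ⟨i, q, hq, rfl⟩ := mem_paths_query.1 hp
      exact Finset.mem_biUnion.2 ⟨i, Finset.mem_univ i, Finset.mem_image.2 ⟨q, hq, rfl⟩⟩
    calc _ ≤ _ := Finset.card_le_card hsub
      _ ≤ Finset.card (Finset.univ : Finset (Fin (n + 1))) * 2 ^ L := by
        refine Finset.card_biUnion_le_card_mul _ _ _ fun i _ => ih i (hdet i) L fun q hq => ?_
        simpa using hL _ (mem_paths_query.2 ⟨i, q, hq, rfl⟩)
      _ ≤ 2 ^ (L + 1) := by
        rw [Finset.card_univ, Fintype.card_fin, pow_succ, mul_comm]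
        exact Nat.mul_le_mul_left _ hn

/-- Assignments giving the same answer to the query follow the same edge. -/
theorem exists_child {f n : ℕ} {label : Fin (n + 1) → Fin 2} {child : Fin (n + 1) → Node 2}
    (hinj : Function.Injective label) {C : Finset ℕ → Prop} {b : Finset ℕ} (hne : ∃ a, C a)
    (hC : ∀ a, C a → (f ∈ a ↔ f ∈ b))
    (hcov : ∀ a, C a → ∃ p ∈ (query f n label child).paths, Agrees a p.1) :
    ∃ i, (∀ a, C a → ∃ q ∈ (child i).paths, Agrees a q.1) ∧
      ∀ a, C a → ∀ q : Word 2, Agrees a q → Agrees a ((f, label i) :: q) := by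
  obtain ⟨a₀, h₀⟩ := hne
  obtain ⟨p, hp, hpa⟩ := hcov a₀ h₀
  obtain ⟨i, q, -, rfl⟩ := mem_paths_query.1 hp
  have hi : label i = 1 ↔ f ∈ b := (agrees_cons.1 hpa).1.trans (hC a₀ h₀)
  refine ⟨i, fun a ha => ?_, fun a ha q hq => agrees_cons.2 ⟨hi.trans (hC a ha).symm, hq⟩⟩
  obtain ⟨p, hp, hpa⟩ := hcov a ha
  obtain ⟨j, q, hq, rfl⟩ := mem_paths_query.1 hp
  obtain ⟨h1, h2⟩ := agrees_cons.1 hpa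
  have hj : label j = 1 ↔ label i = 1 := (h1.trans (hC a ha)).trans hi.symm
  have : j = i := hinj (by omega)
  exact ⟨q, this ▸ hq, h2⟩

/-- Finding the only place where the assignment differs from `b` needs many queries. -/
theorem exists_long_path_of_flips (N : Node 2) (hN : N.IsDeterministic) {b : Finset ℕ}
    (R : Finset ℕ) {e : ℕ → Finset ℕ} (he : ∀ f ∈ R, ∀ g, g ≠ f → (g ∈ e f ↔ g ∈ b))
    (hcov : ∀ f ∈ R, ∃ p ∈ N.paths, Agrees (e f) p.1)
    (hsound : ∀ f ∈ R, ∀ p ∈ N.paths, Agrees (e f) p.1 → p.2 = f) :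
    ∃ p ∈ N.paths, R.card ≤ p.1.length + 1 := by
  induction N generalizing R with
  | terminal d =>
    refine ⟨_, mem_paths_terminal.2 rfl, ?_⟩
    have hd : ∀ f ∈ R, d = f := fun f hf =>
      hsound f hf _ (mem_paths_terminal.2 rfl) (agrees_nil _)
    simpa using Finset.card_le_one.2 fun f hf g hg => (hd f hf).symm.trans (hd g hg)
  | query f n label child ih =>
    by_cases hR : R.card ≤ 1
    · obtain ⟨p, hp⟩ := (query f n label child).paths_nonempty
      exact ⟨p, hp, by omega⟩
    -- The adversary answers as `b` does. Only the candidate flipped at `f` could answer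
    -- differently, so a query costs at most one element of `R`.
    · have hcard := Finset.pred_card_le_card_erase (s := R) (a := f)
      obtain ⟨g, hg⟩ : (R.erase f).Nonempty := Finset.card_pos.1 (by omega)
      obtain ⟨i, hi1, hi2⟩ := exists_child (child := child) hN.1
        (C := fun a => ∃ g ∈ R.erase f, a = e g) (b := b) ⟨_, g, hg, rfl⟩
        (by
          rintro _ ⟨g, hg, rfl⟩
          exact he g (Finset.mem_of_mem_erase hg) f (Finset.ne_of_mem_erase hg).symm)
        (by
          rintro _ ⟨g, hg, rfl⟩
          exact hcov g (Finset.mem_of_mem_erase hg))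
      obtain ⟨q, hq, hql⟩ := ih i (hN.2 i) (R.erase f)
        (fun g hg => he g (Finset.mem_of_mem_erase hg)) (fun g hg => hi1 _ ⟨g, hg, rfl⟩)
        (fun g hg q hq hag => hsound g (Finset.mem_of_mem_erase hg)
          ((f, label i) :: q.1, q.2) (mem_paths_query.2 ⟨i, q, hq, rfl⟩) (hi2 _ ⟨g, hg, rfl⟩ _ hag))
      refine ⟨_, mem_paths_query.2 ⟨i, q, hq, rfl⟩, ?_⟩
      simp only [List.length_cons]
      omega

end Node

/-! ### The pigeonhole search problem -/

section Pigeonhole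

variable {M t : ℕ}

/-- The assignment in which the pigeon `i` sits in the hole `h i`; the bits of the hole of `i`
are the values of the attributes `e (i, ·)`. -/
def placement (e : Fin M × Fin t ↪ ℕ) (h : Fin M → Finset (Fin t)) : Finset ℕ :=
  (Finset.univ.filter fun q : Fin M × Fin t => q.2 ∈ h q.1).map e

theorem mem_placement {e : Fin M × Fin t ↪ ℕ} {h : Fin M → Finset (Fin t)} {q : Fin M × Fin t} :
    e q ∈ placement e h ↔ q.2 ∈ h q.1 := by
  simp [placement]

/-- The hole of the pigeon `i` under the assignment `a`. -/
def hole (e : Fin M × Fin t ↪ ℕ) (a : Finset ℕ) (i : Fin M) : Finset (Fin t) :=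
  Finset.univ.filter fun j => e (i, j) ∈ a

theorem hole_placement (e : Fin M × Fin t ↪ ℕ) (h : Fin M → Finset (Fin t)) :
    hole e (placement e h) = h := by
  ext i j
  simp [hole, mem_placement]

/-- Codes of the pairs of different pigeons that share a hole. -/
def collisions (e : Fin M × Fin t ↪ ℕ) (a : Finset ℕ) : Finset ℕ :=
  (Finset.univ.filter fun q : Fin M × Fin M => q.1 ≠ q.2 ∧ hole e a q.1 = hole e a q.2).image
    fun q => Nat.pair q.1 q.2

theorem mem_collisions {e : Fin M × Fin t ↪ ℕ} {a : Finset ℕ} {d : ℕ} :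
    d ∈ collisions e a ↔
      ∃ i j : Fin M, i ≠ j ∧ hole e a i = hole e a j ∧ d = Nat.pair i j := by
  simp only [collisions, Finset.mem_image, Finset.mem_filter, Finset.mem_univ, true_and,
    Prod.exists]
  constructor
  · rintro ⟨i, j, ⟨h1, h2⟩, rfl⟩; exact ⟨i, j, h1, h2, rfl⟩
  · rintro ⟨i, j, h1, h2, rfl⟩; exact ⟨i, j, ⟨h1, h2⟩, rfl⟩

/-- An adversary argument: `P` is the set of pigeons already queried, kept in different holes by
`h`. While fewer than `2 ^ t` pigeons are placed, a new one can get a free hole, and no collision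
can be claimed because some pigeon of the claimed pair would still be free to move. -/
theorem Node.exists_long_path_of_pigeons (ht : 0 < t) (e : Fin M × Fin t ↪ ℕ) (N : Node 2)
    (hN : N.IsDeterministic) (P : Finset (Fin M)) (h : Fin M → Finset (Fin t))
    (hinj : Set.InjOn h P)
    (hcov : ∀ h' : Fin M → Finset (Fin t), (∀ i ∈ P, h' i = h i) →
      ∃ p ∈ N.paths, Agrees (placement e h') p.1)
    (hsound : ∀ h' : Fin M → Finset (Fin t), (∀ i ∈ P, h' i = h i) →
      ∀ p ∈ N.paths, Agrees (placement e h') p.1 → p.2 ∈ collisions e (placement e h')) :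
    ∃ p ∈ N.paths, 2 ^ t ≤ p.1.length + P.card := by
  have : Nonempty (Fin t) := ⟨⟨0, ht⟩⟩
  induction N generalizing P h with
  | terminal d =>
    exfalso
    have hd : ∀ h' : Fin M → Finset (Fin t), (∀ i ∈ P, h' i = h i) →
        ∃ i j : Fin M, i ≠ j ∧ h' i = h' j ∧ d = Nat.pair i j := fun h' hh' => by
      simpa [mem_collisions, hole_placement] using
        hsound h' hh' _ (mem_paths_terminal.2 rfl) (agrees_nil _)
    obtain ⟨i, j, hij, hh, hdij⟩ := hd h fun _ _ => rfl
    -- An unplaced pigeon of the announced pair moves to another hole, which exists since `0 < t`;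
    -- the same announcement is then wrong.
    have key : ∀ k ∉ P, k = i ∨ k = j → False := by
      intro k hk hkij
      obtain ⟨v, hv⟩ := exists_ne (h k)
      obtain ⟨i', j', -, hh', hd'⟩ := hd (Function.update h k v) fun l hl => by
        rw [Function.update_of_ne]; rintro rfl; exact hk hl
      obtain ⟨h1, h2⟩ := Nat.pair_eq_pair.1 (hdij.symm.trans hd')
      rw [← Fin.ext h1, ← Fin.ext h2] at hh'
      rcases hkij with rfl | rfl
      · rw [Function.update_self, Function.update_of_ne hij.symm] at hh'
        exact hv (hh'.trans hh.symm)
      · rw [Function.update_self, Function.update_of_ne hij] at hh'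
        exact hv (hh'.symm.trans hh)
    by_cases hi : i ∈ P
    · by_cases hj : j ∈ P
      · exact hij (hinj hi hj hh)
      · exact key j hj (Or.inr rfl)
    · exact key i hi (Or.inl rfl)
  | query f n label child ih =>
    by_cases hP : 2 ^ t ≤ P.card
    · obtain ⟨p, hp⟩ := (query f n label child).paths_nonempty
      exact ⟨p, hp, by omega⟩
    -- One adversary move: at most one more pigeon is fixed, and this must determine the answer to
    -- `f`.
    have step : ∀ (P' : Finset (Fin M)) (g : Fin M → Finset (Fin t)), P ⊆ P' →
        P'.card ≤ P.card + 1 → (∀ i ∈ P, g i = h i) → Set.InjOn g P' →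
        (∀ h' : Fin M → Finset (Fin t), (∀ i ∈ P', h' i = g i) →
          (f ∈ placement e h' ↔ f ∈ placement e g)) →
        ∃ p ∈ (query f n label child).paths, 2 ^ t ≤ p.1.length + P.card := by
      intro P' g hPP' hcard hgh hg hf
      have hext : ∀ h' : Fin M → Finset (Fin t), (∀ i ∈ P', h' i = g i) →
          ∀ i ∈ P, h' i = h i := fun h' hh' i hi => (hh' i (hPP' hi)).trans (hgh i hi)
      obtain ⟨i, hi1, hi2⟩ := exists_child (child := child) hN.1
        (C := fun a => ∃ h' : Fin M → Finset (Fin t), (∀ i ∈ P', h' i = g i) ∧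
          a = placement e h') (b := placement e g) ⟨_, g, fun _ _ => rfl, rfl⟩
        (by rintro _ ⟨h', hh', rfl⟩; exact hf h' hh')
        (by rintro _ ⟨h', hh', rfl⟩; exact hcov h' (hext h' hh'))
      obtain ⟨q, hq, hql⟩ := ih i (hN.2 i) P' g hg (fun h' hh' => hi1 _ ⟨h', hh', rfl⟩)
        (fun h' hh' q hq hag => hsound h' (hext h' hh')
          ((f, label i) :: q.1, q.2) (mem_paths_query.2 ⟨i, q, hq, rfl⟩)
          (hi2 _ ⟨h', hh', rfl⟩ _ hag))
      refine ⟨_, mem_paths_query.2 ⟨i, q, hq, rfl⟩, ?_⟩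
      simp only [List.length_cons]
      omega
    by_cases hf : ∃ q, e q = f
    · obtain ⟨⟨i, j⟩, rfl⟩ := hf
      by_cases hi : i ∈ P
      · refine step P h subset_rfl (Nat.le_succ _) (fun _ _ => rfl) hinj fun h' hh' => ?_
        rw [mem_placement, mem_placement, hh' i hi]
      · obtain ⟨v, hv⟩ : ∃ v, v ∉ P.image h := by
          by_contra! hall
          have h1 : (Finset.univ : Finset (Finset (Fin t))).card ≤ (P.image h).card :=
            Finset.card_le_card fun v _ => hall v
          have h2 := Finset.card_image_le (s := P) (f := h)
          simp only [Finset.card_univ, Fintype.card_finset, Fintype.card_fin] at h1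
          omega
        have hup : ∀ k ∈ P, Function.update h i v k = h k := fun k hk => by
          rw [Function.update_of_ne]; rintro rfl; exact hi hk
        refine step (insert i P) (Function.update h i v) (Finset.subset_insert _ _)
          (Finset.card_insert_le _ _) hup ?_ fun h' hh' => ?_
        · rw [Finset.coe_insert, Set.injOn_insert (by simpa using hi)]
          refine ⟨hinj.congr fun k hk => (hup k hk).symm, ?_⟩
          rintro ⟨k, hk, hkv⟩
          rw [Function.update_self, hup k hk] at hkv
          exact hv (Finset.mem_image.2 ⟨k, hk, hkv⟩)
        · rw [mem_placement, mem_placement, hh' i (Finset.mem_insert_self _ _)]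
    -- An attribute that encodes no bit of a hole always receives the answer `0`.
    · refine step P h subset_rfl (Nat.le_succ _) (fun _ _ => rfl) hinj fun h' _ => ?_
      have : ∀ g, f ∉ placement e g := fun g hfg => by
        obtain ⟨q, -, hq⟩ := Finset.mem_map.1 hfg
        exact hf ⟨q, hq⟩
      simp [this]

end Pigeonhole

/-! ### Hard tables planted in the closure -/

theorem isWord_letters {T : Table 2} {a : Finset ℕ} {l : List ℕ} (hl : ∀ f ∈ l, f ∈ T.attrs) :
    T.IsWord (l.map (letter a)) := by
  intro p hp
  obtain ⟨f, hf, rfl⟩ := List.mem_map.1 hp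
  exact hl f hf

theorem agrees_letters {a b : Finset ℕ} {l : List ℕ} :
    Agrees a (l.map (letter b)) ↔ ∀ f ∈ l, (f ∈ b ↔ f ∈ a) := by
  simp only [Agrees, List.forall_mem_map, letter_agrees]

/-- With one pigeon more than holes every row has a collision, certified by the `2 * t` bits of two
pigeons. Shattering makes every placement a row, so the adversary for deterministic trees is
unrestricted. -/
theorem exists_table_of_shattered (hψ : IsBoundedMeasure ψ) {T : Table 2}
    (hT : T ≠ Table.empty 2) {t : ℕ} (ht : 0 < t) (e : Fin (2 ^ t + 1) × Fin t ↪ ℕ)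
    (he : ∀ q, e q ∈ T.attrs)
    (hsh : ∀ c ⊆ Finset.univ.map e, ∃ a ∈ T.supports, a ∩ Finset.univ.map e = c) :
    ∃ Q ∈ T.closure, nondetComplexity ψ Q ≤ maxAttrComplexity ψ T * (2 * t) ∧
      2 ^ t ≤ detComplexity ψ Q := by
  have hcol : ∀ a, ∃ i j : Fin (2 ^ t + 1), i ≠ j ∧ hole e a i = hole e a j := fun a =>
    Fintype.exists_ne_map_eq_of_card_lt (hole e a) (by simp)
  have hS : Finset.univ.map e ⊆ T.attrs := by
    intro f hf
    obtain ⟨q, -, rfl⟩ := Finset.mem_map.1 hf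
    exact he q
  obtain ⟨Q, hQ, hQe, hQa, hQs, hQd⟩ := Table.exists_mem_closure hT (S := Finset.univ.map e)
    ⟨e (0, ⟨0, ht⟩), by simp⟩ hS (collisions e) (fun a _ => by
      obtain ⟨i, j, hij, hh⟩ := hcol (a ∩ Finset.univ.map e)
      exact ⟨_, mem_collisions.2 ⟨i, j, hij, hh, rfl⟩⟩)
  have heQ : ∀ q, e q ∈ Q.attrs := fun q => by rw [hQa]; simp
  refine ⟨Q, hQ, ?_, ?_⟩
  · refine nondetComplexity_le hQe fun r hr => ?_
    set a := Q.support r.1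
    obtain ⟨i, j, hij, hh⟩ := hcol a
    set bits : Fin (2 ^ t + 1) → List ℕ := fun i => (List.finRange t).map fun k => e (i, k)
    have hbits : ∀ f ∈ bits i ++ bits j, f ∈ Q.attrs := by
      intro f hf
      simp only [bits, List.mem_append, List.mem_map] at hf
      rcases hf with ⟨k, -, rfl⟩ | ⟨k, -, rfl⟩ <;> exact heQ _
    refine ⟨(bits i ++ bits j).map (letter a), Nat.pair i j, isWord_letters hbits, ?_,
      agrees_letters.2 fun _ _ => Iff.rfl, ?_⟩
    · refine (hψ.wordComplexity_le (n := maxAttrComplexity ψ T) fun p hp => ?_).trans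
        (le_of_eq (by
          simp only [bits, List.length_map, List.length_append, List.length_finRange]; ring))
      obtain ⟨f, hf, rfl⟩ := List.mem_map.1 hp
      have := hbits f hf
      rw [hQa] at this
      exact le_maxAttrComplexity (hS this)
    · intro s hs hag
      rw [agrees_letters] at hag
      rw [hQd s hs]
      have hk : ∀ k, hole e a k = hole e (Q.support s.1) k ∨ ¬ (k = i ∨ k = j) := by
        intro k
        by_cases hk : k = i ∨ k = j
        · left
          ext l
          have : e (k, l) ∈ bits i ++ bits j := by
            rcases hk with rfl | rfl <;> simp [bits]
          simpa [hole] using hag _ this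
        · exact Or.inr hk
      have h1 := (hk i).resolve_right (by simp)
      have h2 := (hk j).resolve_right (by simp)
      exact mem_collisions.2 ⟨i, j, hij, by rw [← h1, ← h2, hh], rfl⟩
  · obtain ⟨N, hN, hlen, hcov, hsound⟩ := exists_deterministic_node hψ hQe
    have hrow : ∀ h : Fin (2 ^ t + 1) → Finset (Fin t),
        ∃ r ∈ Q.rows, Q.support r.1 = placement e h := by
      intro h
      have hsub : placement e h ⊆ Finset.univ.map e := Finset.map_subset_map.2 (Finset.subset_univ _)
      obtain ⟨a, ha, hac⟩ := hsh _ hsub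
      refine Table.mem_supports.1 ?_
      rw [hQs, ← hac]
      exact Finset.mem_image_of_mem _ ha
    obtain ⟨p, hp, hpl⟩ := N.exists_long_path_of_pigeons ht e hN ∅ (fun _ => ∅) (by simp)
      (fun h _ => by
        obtain ⟨r, hr, hrh⟩ := hrow h
        rw [← hrh]
        exact hcov r hr)
      (fun h _ p hp hag => by
        obtain ⟨r, hr, hrh⟩ := hrow h
        rw [← hrh] at hag ⊢
        rw [← hQd r hr]
        exact hsound p hp r hr hag)
    have := hlen p hp
    simp only [Finset.card_empty, add_zero] at hpl
    omega

theorem isCover_iff {T : Table 2} {n : ℕ} {U : Finset (Word 2)} :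
    IsCover ψ T n U ↔ (∀ α ∈ U, T.IsWord α ∧ wordComplexity ψ α ≤ n) ∧
      ∀ a ∈ T.supports, ∃ α ∈ U, Agrees a α := by
  refine and_congr_right fun hU => ?_
  constructor
  · intro h a ha
    obtain ⟨r, hr, rfl⟩ := Table.mem_supports.1 ha
    have h1 : r.1 ∈ T.tuples := List.mem_toFinset.2 (List.mem_map_of_mem hr)
    rw [← h] at h1
    obtain ⟨α, hα, hrα⟩ := Finset.mem_biUnion.1 h1
    exact ⟨α, hα, ((Table.mem_subtable_tuples (hU α hα).1).1 hrα).2⟩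
  · intro h
    ext l
    rw [Finset.mem_biUnion]
    constructor
    · rintro ⟨α, hα, hl⟩
      exact ((Table.mem_subtable_tuples (hU α hα).1).1 hl).1
    · intro hl
      obtain ⟨α, hα, hag⟩ := h _ (Finset.mem_image_of_mem _ hl)
      exact ⟨α, hα, (Table.mem_subtable_tuples (hU α hα).1).2 ⟨hl, hag⟩⟩

/-- The decisions of a row are the codes of the words of `U` agreeing with it, so any such word is a
certificate. Irreducibility gives each word a row for which it is the only correct answer; hence
every code occurs at a terminal node. -/
theorem exists_table_of_cover (hψ : IsBoundedMeasure ψ) {T : Table 2} (hT : T ≠ Table.empty 2)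
    {n : ℕ} {U : Finset (Word 2)} (hU : IsIrreducibleCover ψ T n U) :
    ∃ Q ∈ T.closure, nondetComplexity ψ Q ≤ n ∧ U.card ≤ 2 ^ detComplexity ψ Q := by
  classical
  obtain ⟨hcover, hirr⟩ := hU
  obtain ⟨hword, hag⟩ := isCover_iff.1 hcover
  have hinter : ∀ a ∈ T.supports, a ∩ T.attrs = a := fun a ha =>
    Finset.inter_eq_left.2 (Table.subset_attrs_of_mem_supports ha)
  obtain ⟨Q, hQ, hQe, hQa, hQs, hQd⟩ := Table.exists_mem_closure hT (S := T.attrs)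
    (Table.attrs_nonempty hT) subset_rfl
    (fun a => (U.filter fun α => Agrees a α).image Encodable.encode) (fun a ha => by
      obtain ⟨α, hα, h⟩ := hag a ha
      exact ⟨_, Finset.mem_image_of_mem _
        (Finset.mem_filter.2 ⟨hα, by rwa [hinter a ha]⟩)⟩)
  rw [Finset.image_congr (g := id) (fun a ha => hinter a ha), Finset.image_id] at hQs
  refine ⟨Q, hQ, nondetComplexity_le hQe fun r hr => ?_, ?_⟩
  · obtain ⟨α, hα, h⟩ := hag (Q.support r.1) (by rw [← hQs]; exact Table.mem_supports.2 ⟨r, hr, rfl⟩)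
    refine ⟨α, Encodable.encode α, fun p hp => hQa ▸ (hword α hα).1 p hp, (hword α hα).2, h, ?_⟩
    intro s hs hsα
    rw [hQd s hs]
    exact Finset.mem_image_of_mem _ (Finset.mem_filter.2 ⟨hα, hsα⟩)
  · obtain ⟨N, hN, hlen, hcov, hsound⟩ := exists_deterministic_node hψ hQe
    refine le_trans ?_ (N.card_decisions_le hN _ hlen)
    rw [← Finset.card_image_of_injective U Encodable.encode_injective]
    refine Finset.card_le_card fun d hd => ?_
    obtain ⟨α, hα, rfl⟩ := Finset.mem_image.1 hd
    have hne := hirr (U.erase α) (Finset.erase_ssubset hα)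
    rw [isCover_iff, not_and_or] at hne
    have hne := hne.resolve_left fun h => h fun β hβ => hword β (Finset.mem_of_mem_erase hβ)
    push Not at hne
    obtain ⟨a, ha, hne⟩ := hne
    rw [← hQs] at ha
    obtain ⟨r, hr, rfl⟩ := Table.mem_supports.1 ha
    obtain ⟨p, hp, hpr⟩ := hcov r hr
    have hd := hsound p hp r hr hpr
    rw [hQd r hr] at hd
    obtain ⟨β, hβ, hβp⟩ := Finset.mem_image.1 hd
    obtain ⟨hβ, hβr⟩ := Finset.mem_filter.1 hβ
    have : β = α := by
      by_contra hβα
      exact hne β (Finset.mem_erase.2 ⟨hβα, hβ⟩) hβr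
    exact Finset.mem_image.2 ⟨p, hp, by rw [← hβp, this]⟩

theorem isAnnihilating_iff {T : Table 2} {α : Word 2} :
    IsAnnihilating T α ↔ T.IsWord α ∧ (∀ a ∈ T.supports, ¬ Agrees a α) ∧
      ∀ (f : ℕ) (δ σ : Fin 2), (f, δ) ∈ α → (f, σ) ∈ α → δ = σ :=
  and_congr_right fun h => by rw [Table.subtable_eq_empty_iff h]

/-- When letters are removed, only the absence of agreeing rows can fail. -/
theorem IsAnnihilating.subset {T : Table 2} {α β : Word 2} (h : IsAnnihilating T α)
    (hβ : β ⊆ α) (hag : ∀ a ∈ T.supports, ¬ Agrees a β) : IsAnnihilating T β :=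
  isAnnihilating_iff.2 ⟨fun p hp => h.1 p (hβ hp), hag,
    fun f δ σ h1 h2 => h.2.2 f δ σ (hβ h1) (hβ h2)⟩

/-- A repeated letter could be dropped, and consistency excludes two letters with one attribute; so
the length counts attributes. -/
theorem IsIrreducibleAnnihilating.nodup {T : Table 2} {α : Word 2}
    (h : IsIrreducibleAnnihilating T α) : (α.map Prod.fst).Nodup := by
  have h1 : α.dedup = α := by
    by_contra hne
    refine h.2 _ (List.dedup_sublist α) hne (h.1.subset (List.dedup_subset α) fun a ha hag => ?_)
    exact (isAnnihilating_iff.1 h.1).2.1 a ha fun p hp => hag p (List.mem_dedup.2 hp)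
  refine List.Nodup.map_on ?_ (List.dedup_eq_self.1 h1)
  rintro ⟨f, δ⟩ hp ⟨g, σ⟩ hq (rfl : f = g)
  rw [h.1.2.2 f δ σ hp hq]

/-- On the attributes of `α`, the decisions of a row are the places where it violates `α`; a single
query certifies one. By irreducibility, for each attribute some row violates `α` there and nowhere
else, so a deterministic tree must locate a unique flip. The `+ 1` appears because the last
candidate needs no query. -/
theorem exists_table_of_annihilating (hψ : IsBoundedMeasure ψ) {T : Table 2}
    (hT : T ≠ Table.empty 2) {α : Word 2} (hα : IsIrreducibleAnnihilating T α) :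
    ∃ Q ∈ T.closure, nondetComplexity ψ Q ≤ maxAttrComplexity ψ T ∧
      α.length ≤ detComplexity ψ Q + 1 := by
  classical
  obtain ⟨hword, hag, hcons⟩ := isAnnihilating_iff.1 hα.1
  set S := (α.map Prod.fst).toFinset with hSdef
  set b := S.filter fun f => (f, 1) ∈ α with hb
  have hST : S ⊆ T.attrs := by
    intro f hf
    obtain ⟨p, hp, rfl⟩ := List.mem_map.1 (List.mem_toFinset.1 hf)
    exact hword p hp
  have hSne : S.Nonempty := by
    obtain ⟨a, ha⟩ := Table.supports_nonempty hT
    by_contra hS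
    rw [Finset.not_nonempty_iff_eq_empty, hSdef, List.toFinset_eq_empty_iff,
      List.map_eq_nil_iff] at hS
    exact hag a ha (hS ▸ agrees_nil a)
  have hpS : ∀ p ∈ α, p.1 ∈ S := fun p hp => List.mem_toFinset.2 (List.mem_map_of_mem hp)
  have hbα : ∀ p ∈ α, (p.2 = 1 ↔ p.1 ∈ b) := by
    rintro ⟨f, δ⟩ hp
    rw [hb, Finset.mem_filter, and_iff_right (hpS _ hp)]
    exact ⟨fun h => by simpa only [← h] using hp, fun h => hcons f _ _ hp h⟩
  have hSα : ∀ f ∈ S, ∃ p ∈ α, p.1 = f := fun f hf => by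
    simpa [hSdef] using hf
  have hflip : ∀ f ∈ S, ∃ a ∈ T.supports, ∀ g ∈ S, (¬ (g ∈ a ↔ g ∈ b)) ↔ g = f := by
    intro f hf
    obtain ⟨p, hp, hpf⟩ := hSα f hf
    -- Without its letter at `f` the word is no longer annihilating, so a row matches all other
    -- letters; it must differ at `f`, since no row matches `α`.
    have hne : α.filter (fun p => p.1 ≠ f) ≠ α := fun h => by
      rw [List.filter_eq_self] at h
      simpa [hpf] using h p hp
    have hna := hα.2 _ List.filter_sublist hne
    have : ∃ a ∈ T.supports, Agrees a (α.filter fun p => p.1 ≠ f) := by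
      by_contra! hcon
      exact hna (hα.1.subset (fun p hp => List.mem_of_mem_filter hp) hcon)
    obtain ⟨a, ha, haα⟩ := this
    have hoff : ∀ g ∈ S, g ≠ f → (g ∈ a ↔ g ∈ b) := by
      intro g hg hgf
      obtain ⟨q, hq, rfl⟩ := hSα g hg
      rw [← haα q (List.mem_filter.2 ⟨hq, by simpa using hgf⟩), hbα q hq]
    refine ⟨a, ha, fun g hg => ⟨fun h => by_contra fun hgf => h (hoff g hg hgf), ?_⟩⟩
    rintro rfl h
    refine hag a ha fun q hq => ?_
    rw [hbα q hq]
    by_cases hqg : q.1 = g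
    · rw [hqg, h]
    · exact (hoff _ (hpS q hq) hqg).symm
  obtain ⟨Q, hQ, hQe, hQa, hQs, hQd⟩ := Table.exists_mem_closure hT hSne hST
    (fun c => S.filter fun f => ¬ (f ∈ c ↔ f ∈ b)) (fun a ha => by
      by_contra hne
      rw [Finset.not_nonempty_iff_eq_empty, Finset.filter_eq_empty_iff] at hne
      refine hag a ha fun p hp => ?_
      have h := not_not.1 (hne (hpS p hp))
      rw [hbα p hp, ← h, Finset.mem_inter, and_iff_left (hpS p hp)])
  refine ⟨Q, hQ, nondetComplexity_le hQe fun r hr => ?_, ?_⟩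
  · have hd := hQd r hr
    obtain ⟨f, hf⟩ := r.2.2
    rw [hd, Finset.mem_filter] at hf
    refine ⟨[letter (Q.support r.1) f], f, ?_, le_maxAttrComplexity (hST hf.1), ?_, ?_⟩
    · intro p hp
      rw [List.mem_singleton.1 hp, hQa]
      exact hf.1
    · exact agrees_cons.2 ⟨letter_agrees.2 Iff.rfl, agrees_nil _⟩
    · intro s hs hsf
      have := letter_agrees.1 (agrees_cons.1 hsf).1
      rw [hQd s hs, Finset.mem_filter, ← this]
      exact hf
  · obtain ⟨N, hN, hlen, hcov, hsound⟩ := exists_deterministic_node hψ hQe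
    choose! e heT heS using hflip
    have hrow : ∀ f ∈ S, ∃ r ∈ Q.rows, Q.support r.1 = e f ∩ S := fun f hf => by
      refine Table.mem_supports.1 ?_
      rw [hQs]
      exact Finset.mem_image_of_mem _ (heT f hf)
    obtain ⟨p, hp, hpl⟩ := N.exists_long_path_of_flips hN (b := b) S (e := fun f => e f ∩ S)
      (fun f hf g hgf => by
        by_cases hg : g ∈ S
        · rw [Finset.mem_inter, and_iff_left hg]
          exact not_not.1 (mt (heS f hf g hg).1 hgf)
        · exact ⟨fun h => absurd (Finset.mem_inter.1 h).2 hg,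
            fun h => absurd (Finset.mem_filter.1 h).1 hg⟩)
      (fun f hf => by
        obtain ⟨r, hr, hrf⟩ := hrow f hf
        rw [← hrf]
        exact hcov r hr)
      (fun f hf p hp hag => by
        obtain ⟨r, hr, hrf⟩ := hrow f hf
        rw [← hrf] at hag
        have := hsound p hp r hr hag
        rw [hQd r hr, hrf, Finset.mem_filter, Finset.mem_inter, and_iff_left this.1] at this
        exact (heS f hf _ this.1).1 this.2)
    have hcard : S.card = α.length := by
      rw [hSdef, List.toFinset_card_of_nodup hα.nodup, List.length_map]
    have := hlen p hp
    omega

/-! ### Partial maxima and polynomial estimates -/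

open Polynomial

theorem exists_mem_partialMax {S : Set ℕ} {x : ℝ} {B : ℕ} (hB : (B : ℝ) ≤ x)
    (h : ∀ c ∈ S, c ≤ B) : ∃ m ∈ partialMax S, (m : ℝ) ≤ x :=
  ⟨sSup S, ⟨(Set.finite_Iic B).subset h, rfl⟩, le_trans (by exact_mod_cast csSup_le' h) hB⟩

theorem le_of_mem_partialMax {S : Set ℕ} {x : ℝ} (h : ∃ m ∈ partialMax S, (m : ℝ) ≤ x) {c : ℕ}
    (hc : c ∈ S) : (c : ℝ) ≤ x := by
  obtain ⟨m, ⟨hfin, rfl⟩, hm⟩ := h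
  exact le_trans (by exact_mod_cast le_csSup hfin.bddAbove hc) hm

/-- The base is at least `2` even for `n = 0`, so coefficients and sums are absorbed by raising the
exponent. -/
theorem exists_eval_le_pow (p : ℝ[X]) : ∃ c : ℕ, ∀ n : ℕ, p.eval (n : ℝ) ≤ ((n + 2) ^ c : ℕ) := by
  induction p using Polynomial.induction_on' with
  | add p q hp hq =>
    obtain ⟨c, hc⟩ := hp
    obtain ⟨d, hd⟩ := hq
    refine ⟨max c d + 1, fun n => ?_⟩
    have h : (n + 2) ^ c + (n + 2) ^ d ≤ (n + 2) ^ (max c d + 1) := by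
      have h1 : (n + 2) ^ c ≤ (n + 2) ^ max c d := Nat.pow_le_pow_right (by omega) (le_max_left _ _)
      have h2 : (n + 2) ^ d ≤ (n + 2) ^ max c d := Nat.pow_le_pow_right (by omega) (le_max_right _ _)
      have h3 := Nat.mul_le_mul_left ((n + 2) ^ max c d) (Nat.le_add_left 2 n)
      rw [pow_succ]
      linarith
    rw [eval_add]
    refine (add_le_add (hc n) (hd n)).trans ?_
    exact_mod_cast h
  | monomial k a =>
    obtain ⟨m, hm⟩ := exists_nat_ge a
    refine ⟨m + k, fun n => ?_⟩
    have h : m * n ^ k ≤ (n + 2) ^ (m + k) := by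
      rw [pow_add]
      refine Nat.mul_le_mul ?_ (Nat.pow_le_pow_left (by omega) k)
      exact (Nat.lt_two_pow_self (n := m)).le.trans (Nat.pow_le_pow_left (by omega) m)
    rw [eval_monomial]
    calc a * (n : ℝ) ^ k ≤ m * (n : ℝ) ^ k := by gcongr
      _ ≤ _ := by exact_mod_cast h

/-- The exponential beats the power of `t`: with `C = c + 1` and `s = t / (2 * C)`, the factor `t +
1` is at most `2 * C * 2 ^ s`, and its `C`-th power contributes only `2 ^ (s * C)`, about the square
root of `2 ^ t`. Cancelling leaves `2 ^ (s * C) ≤ Y`, whence `2 ^ t ≤ Y ^ 2`. Taking `c + 1` avoids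
division by zero. -/
theorem two_pow_le_of_le {t n c : ℕ} (h : 2 ^ t ≤ (n * (2 * t) + 2) ^ c) :
    2 ^ t ≤ ((4 * (c + 1) * (n + 2)) ^ (c + 1)) ^ 2 := by
  set C := c + 1 with hC
  set s := t / (2 * C) with hs
  set Y := (4 * C * (n + 2)) ^ C with hY
  have hC0 : 0 < 2 * C := by omega
  have ht : t + 1 ≤ 2 * C * 2 ^ s := by
    have h1 : t < 2 * C * (s + 1) := Nat.lt_mul_div_succ t hC0
    have h2 : s + 1 ≤ 2 ^ s := Nat.lt_two_pow_self
    exact h1.trans_le (Nat.mul_le_mul_left _ h2)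
  have hbase : n * (2 * t) + 2 ≤ 4 * C * (n + 2) * 2 ^ s := by
    have : 2 * (t + 1) * (n + 2) ≤ 2 * (2 * C * 2 ^ s) * (n + 2) := by gcongr
    nlinarith
  have hY' : 2 ^ t ≤ Y * 2 ^ (s * C) := by
    rw [hY, pow_mul, ← mul_pow]
    exact (h.trans (Nat.pow_le_pow_right (by omega) (Nat.le_succ c))).trans
      (Nat.pow_le_pow_left hbase C)
  have hx : 2 ^ (s * C) * 2 ^ (s * C) ≤ 2 ^ t := by
    rw [← pow_add]
    refine Nat.pow_le_pow_right (by omega) ?_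
    have := Nat.div_mul_le_self t (2 * C)
    rw [← hs] at this
    linarith
  have hx' : 2 ^ (s * C) ≤ Y :=
    Nat.le_of_mul_le_mul_right (hx.trans hY') (Nat.two_pow_pos _)
  rw [sq]
  exact hY'.trans (Nat.mul_le_mul_left _ hx')

/-! ### Complete tables and bounds on the parameters -/

theorem Table.attrs_subset_of_mem_closure {T Q : Table 2} (hQ : Q ∈ T.closure) :
    Q.attrs ⊆ T.attrs := by
  obtain ⟨D, -, ν, rfl⟩ := hQ
  intro f hf
  change f ∈ (removeColumns D T).cols.toFinset at hf
  unfold removeColumns build at hf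
  split_ifs at hf
  · simp only [List.mem_toFinset, List.mem_filter] at hf
    exact List.mem_toFinset.2 hf.1
  · simp [empty] at hf

theorem maxAttrComplexity_le {T : Table 2} {n : ℕ} (h : ∀ f ∈ T.attrs, ψ [f] ≤ n) :
    maxAttrComplexity ψ T ≤ n :=
  Finset.sup_le h

theorem Table.card_attrs (T : Table 2) : T.attrs.card = T.cols.length :=
  List.toFinset_card_of_nodup T.cols_nodup

theorem isComplete_iff {Q : Table 2} : IsComplete Q ↔ Q.supports = Q.attrs.powerset := by
  have hsub : Q.supports ⊆ Q.attrs.powerset := fun a ha =>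
    Finset.mem_powerset.2 (Table.subset_attrs_of_mem_supports ha)
  rw [IsComplete, ← Q.card_supports, ← Finset.card_powerset]
  exact ⟨fun h => Finset.eq_of_subset_of_card_le hsub h.ge, fun h => by rw [h]⟩

/-- The largest pigeonhole instance that fits into `m` columns: it uses `(2 ^ t + 1) * t` of them,
and maximality bounds `m` polynomially in `2 ^ t`. -/
theorem exists_between_sizes (m : ℕ) :
    ∃ t, (2 ^ t + 1) * t ≤ m ∧ m ≤ 4 * (2 ^ t) ^ 2 := by
  have hex : ∃ t, m < (2 ^ (t + 1) + 1) * (t + 1) := ⟨m, by nlinarith [Nat.zero_le (2 ^ (m + 1))]⟩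
  classical
  refine ⟨Nat.find hex, ?_, ?_⟩
  · rcases h : Nat.find hex with _ | t
    · simp
    · exact not_lt.1 (Nat.find_min hex (m := t) (by omega))
  · have h1 := Nat.find_spec hex
    set t := Nat.find hex
    have h2 : t + 1 ≤ 2 ^ t := Nat.lt_two_pow_self
    have h3 : 2 ^ (t + 1) + 1 ≤ 4 * 2 ^ t := by rw [pow_succ]; omega
    have := Nat.mul_le_mul h3 h2
    nlinarith

/-- The number of columns of a complete table is bounded in terms of the complexity of its
attributes when `ψ^d` is polynomially bounded in `ψ^a`. -/
theorem card_attrs_le_of_isComplete (hψ : IsBoundedMeasure ψ) {Q : Table 2} (hQ : IsComplete Q)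
    {n c : ℕ} (hn : maxAttrComplexity ψ Q ≤ n)
    (h : ∀ Q' ∈ Q.closure, ∀ m, nondetComplexity ψ Q' ≤ m → detComplexity ψ Q' ≤ (m + 2) ^ c) :
    Q.attrs.card ≤ 4 * (((4 * (c + 1) * (n + 2)) ^ (c + 1)) ^ 2) ^ 2 := by
  obtain ⟨t, ht1, ht2⟩ := exists_between_sizes Q.attrs.card
  refine ht2.trans (Nat.mul_le_mul_left _ (Nat.pow_le_pow_left ?_ 2))
  rcases Nat.eq_zero_or_pos t with rfl | ht
  · exact Nat.one_le_iff_ne_zero.2 (by positivity)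
  have hQe : Q ≠ Table.empty 2 := by
    rintro rfl
    simp [IsComplete, Table.empty, Table.attrs] at hQ
  obtain ⟨e⟩ : Nonempty (Fin (2 ^ t + 1) × Fin t ↪ {f // f ∈ Q.attrs}) :=
    Function.Embedding.nonempty_of_card_le (by simpa using ht1)
  obtain ⟨Q', hQ', h1, h2⟩ := exists_table_of_shattered hψ hQe ht
    (e.trans (Function.Embedding.subtype _)) (fun q => (e q).2) (fun c hc => by
      refine ⟨c, ?_, Finset.inter_eq_left.2 hc⟩
      rw [isComplete_iff.1 hQ, Finset.mem_powerset]
      intro f hf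
      obtain ⟨q, -, rfl⟩ := Finset.mem_map.1 (hc hf)
      exact (e q).2)
  exact two_pow_le_of_le (h2.trans (h Q' hQ' _ (h1.trans (Nat.mul_le_mul_right _ hn))))

theorem completeDim_le {T : Table 2} {B : ℕ}
    (h : ∀ Q ∈ T.closure, IsComplete Q → Q.attrs.card ≤ B) : completeDim T ≤ B := by
  rw [completeDim]
  split_ifs
  · exact Nat.zero_le _
  · refine csSup_le' ?_
    rintro m ⟨Q, hQ, hc, rfl⟩
    rw [← Q.card_attrs]
    exact h Q hQ hc

theorem annihilatingLength_le {T : Table 2} {B : ℕ}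
    (h : T ≠ Table.empty 2 → ∀ α, IsIrreducibleAnnihilating T α → α.length ≤ B) :
    annihilatingLength T ≤ B := by
  rw [annihilatingLength]
  split_ifs with hT
  · exact Nat.zero_le _
  · refine csSup_le' ?_
    rintro m ⟨α, hα, rfl⟩
    exact h hT α hα

theorem coverNumber_le {T : Table 2} {n B : ℕ}
    (h : T ≠ Table.empty 2 → ∀ U, IsIrreducibleCover ψ T n U → U.card ≤ B) :
    coverNumber ψ T n ≤ B := by
  rw [coverNumber]
  split_ifs with hT
  · exact Nat.zero_le _
  · refine csSup_le' ?_
    rintro m ⟨U, hU, rfl⟩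
    exact h hT U hU

/-! ### Bounding deterministic complexity by the three parameters -/

theorem card_le_completeDim {T : Table 2} (hT : T ≠ Table.empty 2) {S : Finset ℕ}
    (hS : S ⊆ T.attrs) (hsh : T.supports.Shatters S) : S.card ≤ completeDim T := by
  rcases S.eq_empty_or_nonempty with rfl | hne
  · simp
  obtain ⟨Q, hQ, -, hQa, hQs, -⟩ := Table.exists_mem_closure hT hne hS (fun _ => {0})
    fun _ _ => Finset.singleton_nonempty 0
  have hc : IsComplete Q := by
    rw [isComplete_iff, hQs, hQa]
    ext c
    simp only [Finset.mem_image, Finset.mem_powerset]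
    constructor
    · rintro ⟨a, -, rfl⟩; exact Finset.inter_subset_right
    · intro hc
      obtain ⟨a, ha, hac⟩ := hsh hc
      exact ⟨a, ha, by rw [Finset.inter_comm, hac]⟩
  rw [completeDim, if_neg hT]
  refine le_csSup ⟨T.attrs.card, ?_⟩ ⟨Q, hQ, hc, by rw [← Q.card_attrs, hQa]⟩
  rintro m ⟨Q, hQ, -, rfl⟩
  rw [← Q.card_attrs]
  exact Finset.card_le_card (Table.attrs_subset_of_mem_closure hQ)

theorem inter_eq_inter_iff {a b S : Finset ℕ} : a ∩ S = b ∩ S ↔ ∀ f ∈ S, (f ∈ a ↔ f ∈ b) := by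
  simp only [Finset.ext_iff, Finset.mem_inter]
  exact forall_congr' fun f => by tauto

/-- A missing row is excluded by an annihilating word of length at most `G(T)`. -/
theorem exists_card_le_annihilatingLength {T : Table 2} (hT : T ≠ Table.empty 2) {b : Finset ℕ}
    (h : ∀ a ∈ T.supports, a ∩ T.attrs ≠ b ∩ T.attrs) :
    ∃ S ⊆ T.attrs, S.card ≤ annihilatingLength T ∧ ∀ a ∈ T.supports, a ∩ S ≠ b ∩ S := by
  -- Minimality of a refuting set of attributes is what makes the corresponding word irreducible.
  obtain ⟨S, hSle, hS⟩ := exists_minimal_le_of_wellFoundedLT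
    (fun S => ∀ a ∈ T.supports, a ∩ S ≠ b ∩ S) T.attrs h
  refine ⟨S, hSle, ?_, hS.prop⟩
  have key : ∀ l : List ℕ, l ⊆ S.toList → (∀ a ∈ T.supports, a ∩ l.toFinset ≠ b ∩ l.toFinset) →
      IsAnnihilating T (l.map (letter b)) := by
    intro l hl hlb
    refine isAnnihilating_iff.2 ⟨isWord_letters fun f hf => hSle (Finset.mem_toList.1 (hl hf)),
      fun a ha hag => hlb a ha ?_, ?_⟩
    · rw [agrees_letters] at hag
      exact inter_eq_inter_iff.2 fun f hf => (hag f (List.mem_toFinset.1 hf)).symm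
    · intro f δ σ h1 h2
      obtain ⟨g, -, hg⟩ := List.mem_map.1 h1
      obtain ⟨g', -, hg'⟩ := List.mem_map.1 h2
      simp only [letter, Prod.mk.injEq] at hg hg'
      rw [← hg.2, ← hg'.2, hg.1, hg'.1]
  have hirr : IsIrreducibleAnnihilating T (S.toList.map (letter b)) := by
    refine ⟨key _ (List.Subset.refl _) (by simpa using hS.prop), fun β hβ hne hann => ?_⟩
    obtain ⟨l, hl, rfl⟩ := List.sublist_map_iff.1 hβ
    have hsub : l.toFinset ≤ S := fun f hf => Finset.mem_toList.1 (hl.subset (List.mem_toFinset.1 hf))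
    have hlS : S ≤ l.toFinset := by
      refine hS.le_of_le (fun a ha hab => ?_) hsub
      refine (isAnnihilating_iff.1 hann).2.1 a ha (agrees_letters.2 fun f hf => ?_)
      exact (inter_eq_inter_iff.1 hab f (List.mem_toFinset.2 hf)).symm
    refine hne ?_
    rw [hl.eq_of_length_le]
    rw [Finset.length_toList]
    exact (Finset.card_le_card hlS).trans (List.toFinset_card_le l)
  rw [annihilatingLength, if_neg hT]
  refine le_csSup ⟨T.attrs.card, ?_⟩ ⟨_, hirr, by simp⟩
  rintro m ⟨α, hα, rfl⟩
  rw [← List.length_map (f := Prod.fst), ← List.toFinset_card_of_nodup hα.nodup]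
  refine Finset.card_le_card fun f hf => ?_
  obtain ⟨p, hp, rfl⟩ := List.mem_map.1 (List.mem_toFinset.1 hf)
  exact hα.1.1 p hp

/-- Bounded complexity bounds length. Without this the supremum in `coverNumber` could be taken over
an unbounded set and have the default value `0`. -/
theorem finite_words (hψ : IsBoundedMeasure ψ) (T : Table 2) (n : ℕ) :
    {α : Word 2 | T.IsWord α ∧ wordComplexity ψ α ≤ n}.Finite := by
  refine ((List.finite_length_le {p // p ∈ T.attrs ×ˢ (Finset.univ : Finset (Fin 2))} n).image
    (List.map Subtype.val)).subset ?_
  rintro α ⟨hα, hn⟩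
  refine ⟨α.pmap Subtype.mk fun p hp => Finset.mem_product.2 ⟨hα p hp, Finset.mem_univ _⟩, ?_,
    by simp [List.map_pmap]⟩
  simpa using (hψ.length_le_wordComplexity α).trans hn

theorem card_le_coverNumber (hψ : IsBoundedMeasure ψ) {T : Table 2} (hT : T ≠ Table.empty 2)
    {n : ℕ} {U : Finset (Word 2)} (hU : IsIrreducibleCover ψ T n U) :
    U.card ≤ coverNumber ψ T n := by
  rw [coverNumber, if_neg hT]
  refine le_csSup ⟨(finite_words hψ T n).toFinset.card, ?_⟩ ⟨U, hU, rfl⟩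
  rintro m ⟨V, hV, rfl⟩
  exact Finset.card_le_card fun α hα => (Set.Finite.mem_toFinset _).2 (hV.1.1 α hα)

theorem IsCover.exists_irreducible {T : Table 2} {n : ℕ} {U : Finset (Word 2)}
    (hU : IsCover ψ T n U) : ∃ V ⊆ U, IsIrreducibleCover ψ T n V := by
  obtain ⟨V, hVU, hV⟩ := exists_minimal_le_of_wellFoundedLT (IsCover ψ T n) U hU
  exact ⟨V, hVU, hV.prop, fun V' hV' h => hV'.2 (hV.le_of_le h hV'.1)⟩

theorem card_filter_card_le (B : Finset ℕ) (z : ℕ) :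
    (B.powerset.filter fun S => S.card ≤ z).card ≤ (B.card + 1) ^ z := by
  induction z with
  | zero =>
    rw [pow_zero, Finset.card_le_one]
    intro S hS S' hS'
    have h1 := (Finset.mem_filter.1 hS).2
    have h2 := (Finset.mem_filter.1 hS').2
    rw [Nat.le_zero, Finset.card_eq_zero] at h1 h2
    rw [h1, h2]
  | succ z ih =>
    have hsub : (B.powerset.filter fun S => S.card ≤ z + 1) ⊆
        (B.powerset.filter fun S => S.card ≤ z) ∪ B.powersetCard (z + 1) := by
      intro S hS
      simp only [Finset.mem_union, Finset.mem_filter, Finset.mem_powerset,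
        Finset.mem_powersetCard] at hS ⊢
      rcases hS.2.lt_or_eq with h | h
      · exact Or.inl ⟨hS.1, by omega⟩
      · exact Or.inr ⟨hS.1, h⟩
    have h1 := (Finset.card_le_card hsub).trans (Finset.card_union_le _ _)
    have h2 : (B.powersetCard (z + 1)).card ≤ B.card ^ z * B.card := by
      rw [Finset.card_powersetCard, ← pow_succ]
      exact Nat.choose_le_pow _ _
    have h3 : B.card ^ z * B.card ≤ (B.card + 1) ^ z * B.card :=
      Nat.mul_le_mul_right _ (Nat.pow_le_pow_left (Nat.le_succ _) z)
    rw [pow_succ, mul_add, mul_one]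
    omega

/-- The Sauer–Shelah bound. -/
theorem card_le_of_shatters {F : Finset (Finset ℕ)} {B : Finset ℕ} {z : ℕ}
    (hF : ∀ a ∈ F, a ⊆ B) (hz : ∀ S ⊆ B, F.Shatters S → S.card ≤ z) :
    F.card ≤ (B.card + 1) ^ z := by
  refine (F.card_le_card_shatterer).trans (le_trans ?_ (card_filter_card_le B z))
  refine Finset.card_le_card fun S hS => ?_
  rw [Finset.mem_shatterer] at hS
  obtain ⟨a, ha, haS⟩ := hS.exists_superset
  have hSB : S ⊆ B := haS.trans (hF a ha)
  exact Finset.mem_filter.2 ⟨Finset.mem_powerset.2 hSB, hz S hSB hS⟩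

/-- The polynomial bound of `ψ^d` in terms of bounds `z`, `g`, `2 ^ l` of the other
parameters. -/
theorem detComplexity_le_of_bounds (hψ : IsBoundedMeasure ψ) {T : Table 2} {n z g l : ℕ}
    (hn : nondetComplexity ψ T ≤ n)
    (hz : ∀ Q ∈ T.closure, maxAttrComplexity ψ Q ≤ n → completeDim Q ≤ z)
    (hg : ∀ Q ∈ T.closure, maxAttrComplexity ψ Q ≤ n → annihilatingLength Q ≤ g)
    (hl : coverNumber ψ T n ≤ 2 ^ l) :
    detComplexity ψ T ≤ n * ((g + n) * ((n + l) * z + 1)) := by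
  classical
  by_cases hT : T = Table.empty 2
  · simp [detComplexity, hT]
  obtain ⟨Γ, hΓ, hΓn⟩ := exists_nondeterministic_eq (ψ := ψ) hT
  rw [← hΓn] at hn
  obtain ⟨hΓa, hΓc, hΓd⟩ := Tree.isNondeterministicFor_iff.1 hΓ
  have hcover : IsCover ψ T n (Γ.paths.image Prod.fst) := by
    rw [isCover_iff]
    constructor
    · intro α hα
      obtain ⟨p, hp, rfl⟩ := Finset.mem_image.1 hα
      exact ⟨fun q hq => hΓa (Tree.fst_mem_attrs hp q hq),
        (wordComplexity_le_treeComplexity hp).trans hn⟩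
    · intro a ha
      obtain ⟨r, hr, rfl⟩ := Table.mem_supports.1 ha
      obtain ⟨p, hp, hpr⟩ := hΓc r hr
      exact ⟨p.1, Finset.mem_image_of_mem _ hp, hpr⟩
  obtain ⟨V, hVU, hV⟩ := hcover.exists_irreducible
  obtain ⟨hVw, hVc⟩ := isCover_iff.1 hV.1
  have hVcard : V.card ≤ 2 ^ l := (card_le_coverNumber hψ hT hV).trans hl
  -- Only attributes occurring in the irreducible subcover are ever queried; they have complexity at
  -- most `n`, and there are fewer than `2 ^ (n + l)` of them.
  set B := V.biUnion fun α => (α.map Prod.fst).toFinset with hB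
  have hBmem : ∀ α ∈ V, ∀ p ∈ α, p.1 ∈ B := fun α hα p hp =>
    Finset.mem_biUnion.2 ⟨α, hα, List.mem_toFinset.2 (List.mem_map_of_mem hp)⟩
  have hBex : ∀ f ∈ B, ∃ α ∈ V, ∃ p ∈ α, p.1 = f := by
    intro f hf
    obtain ⟨α, hα, hf⟩ := Finset.mem_biUnion.1 hf
    obtain ⟨p, hp, rfl⟩ := List.mem_map.1 (List.mem_toFinset.1 hf)
    exact ⟨α, hα, p, hp, rfl⟩
  have hBT : B ⊆ T.attrs := by
    intro f hf
    obtain ⟨α, hα, p, hp, rfl⟩ := hBex f hf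
    exact (hVw α hα).1 p hp
  have hBn : ∀ f ∈ B, ψ [f] ≤ n := by
    intro f hf
    obtain ⟨α, hα, p, hp, rfl⟩ := hBex f hf
    exact (hψ.letter_le hp).trans (hVw α hα).2
  have hlen : ∀ α ∈ V, α.length ≤ n := fun α hα =>
    (hψ.length_le_wordComplexity α).trans (hVw α hα).2
  have hBcard : B.card + 1 ≤ 2 ^ (n + l) := by
    have h1 : B.card ≤ V.card * n := Finset.card_biUnion_le_card_mul _ _ _ fun α hα =>
      (List.toFinset_card_le _).trans (by simpa using hlen α hα)
    have h2 : V.card * n ≤ 2 ^ l * n := Nat.mul_le_mul_right _ hVcard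
    have h3 : n + 1 ≤ 2 ^ n := Nat.lt_two_pow_self
    have h4 : 1 ≤ 2 ^ l := Nat.one_le_two_pow
    have h5 := Nat.mul_le_mul_left (2 ^ l) h3
    rw [pow_add, mul_comm]
    linarith
  have hW : ∀ a ∈ T.supports, ∃ w ∈ Γ.paths.filter fun p => p.1 ∈ V, Agrees a w.1 := by
    intro a ha
    obtain ⟨α, hα, haα⟩ := hVc a ha
    obtain ⟨p, hp, rfl⟩ := Finset.mem_image.1 (hVU hα)
    exact ⟨p, Finset.mem_filter.2 ⟨hp, hα⟩, haα⟩
  -- A round costs at most `K = g + n`, covering both refutations (at most `g`) and certificates (at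
  -- most `n`); the number of rounds is `(n + l) * z + 1`, the `+ 1` making the row count strictly
  -- smaller than the power of two.
  refine detComplexity_le (exists_deterministic hψ hBT hBn hW
    (fun w hw => hBmem _ (Finset.mem_filter.1 hw).2)
    (fun w hw => hΓd w (Finset.mem_filter.1 hw).1)
    (fun w hw => (hlen _ (Finset.mem_filter.1 hw).2).trans (Nat.le_add_left n g)) ?_ ?_)
  · intro b hb hbT
    -- With `B` empty the restricted table would be `Λ`; here every row trivially matches `b`.
    rcases B.eq_empty_or_nonempty with hB0 | hBne
    · obtain ⟨a, ha⟩ := Table.supports_nonempty hT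
      refine absurd ?_ (hbT a ha)
      rw [hB0] at hb ⊢
      rw [Finset.subset_empty.1 hb, Finset.inter_empty]
    · obtain ⟨Q, hQ, hQe, hQa, hQs, -⟩ := Table.exists_mem_closure hT hBne hBT (fun _ => {0})
        fun _ _ => Finset.singleton_nonempty 0
      obtain ⟨S, hSQ, hSc, hS⟩ := exists_card_le_annihilatingLength hQe (b := b) (by
        intro a' ha'
        rw [hQs] at ha'
        obtain ⟨a, ha, rfl⟩ := Finset.mem_image.1 ha'
        rw [hQa, Finset.inter_assoc, Finset.inter_self, Finset.inter_eq_left.2 hb]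
        exact hbT a ha)
      rw [hQa] at hSQ
      refine ⟨S, hSQ, (hSc.trans (hg Q hQ (maxAttrComplexity_le ?_))).trans (Nat.le_add_right g n),
        fun a ha => ?_⟩
      · rw [hQa]; exact hBn
      · have := hS _ (by rw [hQs]; exact Finset.mem_image_of_mem _ ha)
        rwa [Finset.inter_assoc, Finset.inter_eq_right.2 hSQ] at this
  · have hsub : ∀ a ∈ T.supports.image (· ∩ B), a ⊆ B := by
      intro a' ha'
      obtain ⟨a, -, rfl⟩ := Finset.mem_image.1 ha'
      exact Finset.inter_subset_right
    have h1 := card_le_of_shatters (z := z) hsub fun S hSB hS => by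
      rcases B.eq_empty_or_nonempty with hB0 | hBne
      · rw [hB0, Finset.subset_empty] at hSB
        simp [hSB]
      · obtain ⟨Q, hQ, hQe, hQa, hQs, -⟩ := Table.exists_mem_closure hT hBne hBT (fun _ => {0})
          fun _ _ => Finset.singleton_nonempty 0
        refine (card_le_completeDim hQe (hQa ▸ hSB) (hQs ▸ hS)).trans
          (hz Q hQ (maxAttrComplexity_le ?_))
        rw [hQa]; exact hBn
    refine (h1.trans (Nat.pow_le_pow_left hBcard z)).trans_lt ?_
    rw [← pow_mul]
    exact Nat.pow_lt_pow_right (by omega) (Nat.lt_succ_self _)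

end DecisionTables

/-! ### The equivalence -/

open DecisionTables in
theorem theorem4 (A : Set (Table 2)) (hA : IsClosedClass A) (hA' : IsNontrivialClass A)
    (ψ : List ℕ → ℕ) (hψ : IsBoundedMeasure ψ) (hH : EverywhereDefined (funH ψ A)) :
    (∃ p₀ : Polynomial ℝ, ∀ n : ℕ, ∃ h ∈ funH ψ A n, (h : ℝ) ≤ p₀.eval (n : ℝ)) ↔
      ∃ p₁ p₂ p₃ : Polynomial ℝ, ∀ n : ℕ,
        (∃ z ∈ funZ ψ A n, (z : ℝ) ≤ p₁.eval (n : ℝ)) ∧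
        (∃ g ∈ funG ψ A n, (g : ℝ) ≤ p₂.eval (n : ℝ)) ∧
        (∃ l ∈ funL ψ A n, (l : ℝ) ≤ (2 : ℝ) ^ p₃.eval (n : ℝ)) := by
  open Polynomial in
  constructor
  · rintro ⟨p₀, hp₀⟩
    obtain ⟨c, hc⟩ := exists_eval_le_pow p₀
    have hdet : ∀ T ∈ A, ∀ n, nondetComplexity ψ T ≤ n → detComplexity ψ T ≤ (n + 2) ^ c :=
      fun T hT n hn => by
        exact_mod_cast (le_of_mem_partialMax (hp₀ n) ⟨T, hT, hn, rfl⟩).trans (hc n)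
    refine ⟨4 * (((C (4 * ((c : ℝ) + 1)) * (X + 2)) ^ (c + 1)) ^ 2) ^ 2, (X + 2) ^ c + 1,
      (X + 2) ^ c, fun n => ⟨?_, ?_, ?_⟩⟩
    · refine exists_mem_partialMax (B := 4 * (((4 * (c + 1) * (n + 2)) ^ (c + 1)) ^ 2) ^ 2)
        (by simp) ?_
      rintro _ ⟨T, ⟨hT, hn⟩, rfl⟩
      refine completeDim_le fun Q hQ hcQ => card_attrs_le_of_isComplete hψ hcQ
        (maxAttrComplexity_le fun f hf =>
          (le_maxAttrComplexity (Table.attrs_subset_of_mem_closure hQ hf)).trans hn) ?_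
      -- The planted table lies in the closure of a complete table that itself lies in the closure
      -- of `T`, so closedness is used twice.
      exact fun Q' hQ' => hdet Q' (hA.closure_subset (hA.closure_subset hT hQ) hQ')
    · refine exists_mem_partialMax (B := (n + 2) ^ c + 1) (by simp) ?_
      rintro _ ⟨T, ⟨hT, hn⟩, rfl⟩
      refine annihilatingLength_le fun hTe α hα => ?_
      obtain ⟨Q, hQ, h1, h2⟩ := exists_table_of_annihilating hψ hTe hα
      exact h2.trans (Nat.add_le_add_right (hdet Q (hA.closure_subset hT hQ) n (h1.trans hn)) 1)
    · refine exists_mem_partialMax (B := 2 ^ ((n + 2) ^ c)) (le_of_eq ?_) ?_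
      · have : ((X + 2 : ℝ[X]) ^ c).eval (n : ℝ) = ((n + 2) ^ c : ℕ) := by simp
        rw [this, Real.rpow_natCast]
        norm_cast
      · rintro _ ⟨T, hT, rfl⟩
        refine coverNumber_le fun hTe U hU => ?_
        obtain ⟨Q, hQ, h1, h2⟩ := exists_table_of_cover hψ hTe hU
        exact h2.trans (Nat.pow_le_pow_right (by omega)
          (hdet Q (hA.closure_subset hT hQ) n h1))
  · rintro ⟨p₁, p₂, p₃, hp⟩
    obtain ⟨c₁, hc₁⟩ := exists_eval_le_pow p₁
    obtain ⟨c₂, hc₂⟩ := exists_eval_le_pow p₂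
    obtain ⟨c₃, hc₃⟩ := exists_eval_le_pow p₃
    refine ⟨X * (((X + 2) ^ c₂ + X) * ((X + (X + 2) ^ c₃) * (X + 2) ^ c₁ + 1)), fun n => ?_⟩
    refine exists_mem_partialMax
      (B := n * (((n + 2) ^ c₂ + n) * ((n + (n + 2) ^ c₃) * (n + 2) ^ c₁ + 1))) (by simp) ?_
    rintro _ ⟨T, hT, hn, rfl⟩
    obtain ⟨hz, hg, hl⟩ := hp n
    refine detComplexity_le_of_bounds hψ hn (fun Q hQ hQn => ?_) (fun Q hQ hQn => ?_) ?_
    · exact_mod_cast (le_of_mem_partialMax hz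
        ⟨Q, ⟨hA.closure_subset hT hQ, hQn⟩, rfl⟩).trans (hc₁ n)
    · exact_mod_cast (le_of_mem_partialMax hg
        ⟨Q, ⟨hA.closure_subset hT hQ, hQn⟩, rfl⟩).trans (hc₂ n)
    · have h1 := (le_of_mem_partialMax hl ⟨T, hT, rfl⟩).trans
        (Real.rpow_le_rpow_of_exponent_le one_le_two (hc₃ n))
      rw [Real.rpow_natCast] at h1
      exact_mod_cast h1
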